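/- Let $S$ be a closed connected oriented surface and let $f:S\to S$ be a (generalized) pseudo-Anosov homeomorphism: $f$ preserves the orientation and there are transverse $f$-invariant measured foliations $(\mathcal F^s,\mu^s)$, $(\mathcal F^u,\mu^u)$ on $S$ with the same prong singularities (each point $x$ has $k=k(x)\ge 1$ stable and $k$ unstable separatrices, with $k=2$ outside a discrete set), and a $\lambda>1$ with $f_*\mu^u=\lambda\mu^u$ and $f_*\mu^s=\lambda^{-1}\mu^s$. A rectangle $R$ is the image of a continuous map $\rho:[0,1]^2\to S$ which restricts to an orientation-preserving homeomorphism from the open square $(0,1)^2$ onto an open set $\mathring R$ (the interior of $R$) and which maps each horizontal (vertical) segment homeomorphically onto an arc in a stable (unstable) leaf. A horizontal (vertical) sub-rectangle of $R$ is a rectangle contained in $R$ whose horizontal (vertical) leaves through interior points are horizontal (vertical) leaves of $R$. Let $\mathcal R=\{R_1,\dots,R_n\}$ be a geometric Markov partition of $f$: finitely many rectangles, each with a chosen vertical direction, covering $S$, with pairwise disjoint interiors, such that for all $i,j$ each nonempty connected component of $\mathring R_i\cap f^{-1}(\mathring R_j)$ is the interior of a horizontal sub-rectangle of $R_i$ and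 each nonempty connected component of $f(\mathring R_i)\cap\mathring R_j$ is the interior of a vertical sub-rectangle of $R_j$; the closures of these components are called the horizontal, respectively vertical, sub-rectangles of $(f,\mathcal R)$. The incidence matrix $A=A(f,\mathcal R)=(a_{ik})$ is given by: $a_{ik}$ is the number of horizontal sub-rectangles of $(f,\mathcal R)$ in $R_i$ that $f$ maps to vertical sub-rectangles of $(f,\mathcal R)$ in $R_k$. Let $\Sigma_A=\{w\in\{1,\dots,n\}^{\mathbb Z}: a_{w_zw_{z+1}}=1 \text{ for all } z\in\mathbb Z\}$ with the product topology, and let $\sigma_A:\Sigma_A\to\Sigma_A$, $(\sigma_A w)_z=w_{z+1}$, be the shift. Let $x\in S$ have $k$ separatrices of each kind. The $k$ stable and $k$ unstable local separatrices of $x$ cut a small neighbourhood of $x$ into $2k$ open regions $E_1,\dots,E_{2k}$; the sector $e_j(x)$ is the set of sequences that converge to $x$ and are eventually in $E_j$. A sector code of $e_j(x)$ is a word $w\in\{1,\dots,n\}^{\mathbb Z}$ such that for every $z\in\mathbb Z$ the sector $f^z(e_j(x))$ is contained in $R_{w_z}$, that is, each sequence of $f^z(e_j(x))$ is eventually in $R_{w_z}$.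 Assume that $A$ is binary, i.e. all its entries are $0$ or $1$. Then: 1. For every $w\in\Sigma_A$ the set $\bigcap_{m\in\mathbb N}\overline{\bigcap_{z=-m}^{m}f^{-z}(\mathring R_{w_z})}$ consists of a single point $\pi(w)$, and the map $\pi:\Sigma_A\to S$ is continuous, surjective and finite-to-one. 2. $f\circ\pi=\pi\circ\sigma_A$. 3. For every $x\in S$ with $k$ stable (equivalently, unstable) separatrices, each sector $e_j(x)$, $1\le j\le 2k$, has exactly one sector code $\underline{e}_j(x)$; it belongs to $\Sigma_A$, and $\pi^{-1}(x)=\{\underline{e}_j(x): 1\le j\le 2k\}$. In particular $\pi^{-1}(x)$ has at most $2k$ elements. -/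

import Mathlib

open Set Filter Topology

namespace PseudoAnosov

/-- A pair `(F^s, F^u)` of transverse measured foliations with common prong singularities on an
oriented surface `S`, given by an oriented atlas of adapted charts, one centred at each point.

In the chart `z` centred at `p`, where `p` has `k = prongs p` stable and `k` unstable separatrices,
the local coordinate `w = z ^ (k / 2)` (that is, `w ^ 2 = z ^ k`, defined up to sign) is such that
`F^s` is `{Im w = const}` with transverse measure `|d Im w|`, and `F^u` is `{Re w = const}` with
transverse measure `|d Re w|`. Thus `k = 2` at a regular point, `k = 1` at a spine and `k ≥ 3` at
the other singularities. The compatibility condition says that the singularities are isolated and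
that the charts at `p` and at a nearby `q ≠ p` define the same oriented measured foliations:
their coordinates `w` differ by a sign and a translation. -/
structure TransverseFoliations (S : Type*) [TopologicalSpace S] where
  prongs : S → ℕ
  prongs_pos : ∀ p, 1 ≤ prongs p
  chart : S → OpenPartialHomeomorph S ℂ
  mem_source : ∀ p, p ∈ (chart p).source
  chart_self : ∀ p, chart p p = 0
  compat : ∀ p q, q ∈ (chart p).source → q ≠ p →
    prongs q = 2 ∧ ∃ c : ℂ, ∀ᶠ x in 𝓝 q, (chart q x + c) ^ 2 = chart p x ^ prongs p

/-- The linear map contracting the stable (horizontal) direction by `lam⁻¹` and expanding the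
unstable (vertical) direction by `lam`. -/
noncomputable def stretch (lam : ℝ) (w : ℂ) : ℂ := ⟨lam⁻¹ * w.re, lam * w.im⟩

section Basic

variable {S : Type*} [TopologicalSpace S]

/-- `f` is a (generalized) pseudo-Anosov homeomorphism with invariant foliations `M`: it maps the
foliations to themselves, with the same number of prongs, and multiplies the length along stable
leaves by `lam⁻¹` and the length along unstable leaves by `lam`, for some `lam > 1`
(with `f_* μ (γ) = μ (f⁻¹ γ)`, and `μ^u` measuring arcs of stable leaves, this is
`f_* μ^u = lam μ^u` and `f_* μ^s = lam⁻¹ μ^s`). In the local coordinates `w` at `p` and at `f p` it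
is therefore `w ↦ ± stretch lam w`; the same sign on both real coordinates expresses that
`f` preserves the orientation. -/
def IsPseudoAnosov (M : TransverseFoliations S) (f : S ≃ₜ S) : Prop :=
  ∃ lam : ℝ, 1 < lam ∧ ∀ p, M.prongs (f p) = M.prongs p ∧
    ∀ᶠ x in 𝓝 p, ∃ w : ℂ, w ^ 2 = M.chart p x ^ M.prongs p ∧
      stretch lam w ^ 2 = M.chart (f p) (f x) ^ M.prongs (f p)

namespace TransverseFoliations

variable (M : TransverseFoliations S)

/-- The union of `p` and its local stable separatrices: `Im w = 0`, i.e. `z ^ k ∈ [0, ∞)`. -/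
def stablePlaque (p : S) : Set S :=
  {x | x ∈ (M.chart p).source ∧ ∃ r : ℝ, 0 ≤ r ∧ M.chart p x ^ M.prongs p = (r : ℂ)}

/-- The union of `p` and its local unstable separatrices: `Re w = 0`, i.e. `z ^ k ∈ (-∞, 0]`. -/
def unstablePlaque (p : S) : Set S :=
  {x | x ∈ (M.chart p).source ∧ ∃ r : ℝ, 0 ≤ r ∧ M.chart p x ^ M.prongs p = -(r : ℂ)}

/-- The path `γ : [0,1] → S` runs inside one stable leaf. -/
def IsStablePath (γ : ℝ → S) : Prop :=
  ContinuousOn γ (Icc 0 1) ∧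
    ∀ t₀ ∈ Icc (0 : ℝ) 1, ∀ᶠ t in 𝓝[Icc 0 1] t₀, γ t ∈ M.stablePlaque (γ t₀)

/-- The path `γ : [0,1] → S` runs inside one unstable leaf. -/
def IsUnstablePath (γ : ℝ → S) : Prop :=
  ContinuousOn γ (Icc 0 1) ∧
    ∀ t₀ ∈ Icc (0 : ℝ) 1, ∀ᶠ t in 𝓝[Icc 0 1] t₀, γ t ∈ M.unstablePlaque (γ t₀)

/-- The `j`-th of the `2k` open regions, in counterclockwise order, into which the `k` stable and
`k` unstable local separatrices of `p` cut a neighbourhood of `p`. -/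
def sectorRegion (p : S) (j : Fin (2 * M.prongs p)) : Set S :=
  {x | x ∈ (M.chart p).source ∧ ∃ r θ : ℝ, 0 < r ∧
    (j : ℝ) * Real.pi / M.prongs p < θ ∧ θ < ((j : ℝ) + 1) * Real.pi / M.prongs p ∧
    M.chart p x = r * Complex.exp (θ * Complex.I)}

/-- The sector `e_j(p)`: the class of all sequences that converge to `p` inside the `j`-th
region. -/
def sector (p : S) (j : Fin (2 * M.prongs p)) : Set (ℕ → S) :=
  {y | Tendsto y atTop (𝓝 p) ∧ ∀ᶠ m in atTop, y m ∈ M.sectorRegion p j}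

end TransverseFoliations

/-- The image of a sector (more generally, of a class of sequences) under `g`. -/
def mapSector (g : S → S) (e : Set (ℕ → S)) : Set (ℕ → S) := (fun y => g ∘ y) '' e

/-- A sector is contained in `R` if each of its sequences eventually lies in `R`. -/
def SectorContainedIn (e : Set (ℕ → S)) (R : Set S) : Prop :=
  ∀ y ∈ e, ∀ᶠ m in atTop, y m ∈ R

/-- A geometrized rectangle: a continuous `param : [0,1]² → S` (values elsewhere are irrelevant)
that is an orientation-preserving homeomorphism of the open square onto an open set, is injective
on each horizontal and on each vertical segment, and maps these into stable leaves and unstable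
leaves. It need not be injective on the boundary of the square. The chosen vertical direction of
the rectangle is that of increasing second coordinate (for the opposite choice, compose `param`
with the rotation of the square by the angle `π`). -/
structure Rectangle (M : TransverseFoliations S) where
  param : ℝ × ℝ → S
  continuousOn : ContinuousOn param (Icc 0 1 ×ˢ Icc 0 1)
  injOn : InjOn param (Ioo 0 1 ×ˢ Ioo 0 1)
  isOpen_image : ∀ U ⊆ Ioo (0 : ℝ) 1 ×ˢ Ioo (0 : ℝ) 1, IsOpen U → IsOpen (param '' U)
  horizontal_injOn : ∀ t ∈ Icc (0 : ℝ) 1, InjOn (fun s => param (s, t)) (Icc 0 1)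
  horizontal_stable : ∀ t ∈ Icc (0 : ℝ) 1, M.IsStablePath (fun s => param (s, t))
  vertical_injOn : ∀ s ∈ Icc (0 : ℝ) 1, InjOn (fun t => param (s, t)) (Icc 0 1)
  vertical_unstable : ∀ s ∈ Icc (0 : ℝ) 1, M.IsUnstablePath (fun t => param (s, t))
  /-- Near each interior point, the first and third quadrants of the square go to quadrants in
  which `Re w` and `Im w` have equal signs. -/
  orientation : ∀ a ∈ Ioo (0 : ℝ) 1 ×ˢ Ioo (0 : ℝ) 1, ∀ᶠ b in 𝓝 a,
    0 < (b.1 - a.1) * (b.2 - a.2) →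
      0 < (M.chart (param a) (param b) ^ M.prongs (param a)).im

namespace Rectangle

variable {M : TransverseFoliations S}

/-- The rectangle as a subset of `S`. -/
def carrier (R : Rectangle M) : Set S := R.param '' (Icc 0 1 ×ˢ Icc 0 1)

/-- The interior of the rectangle: the image of the open square. -/
def inner (R : Rectangle M) : Set S := R.param '' (Ioo 0 1 ×ˢ Ioo 0 1)

/-- The leaves of the horizontal foliation of a rectangle. -/
def horizontalLeaf (R : Rectangle M) (t : ℝ) : Set S := (fun s => R.param (s, t)) '' Icc 0 1

/-- The leaves of the vertical foliation of a rectangle. -/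
def verticalLeaf (R : Rectangle M) (s : ℝ) : Set S := (fun t => R.param (s, t)) '' Icc 0 1

/-- `H` is a horizontal sub-rectangle of `R`: it is contained in `R`, and the horizontal leaf of
`H` through any interior point of `H` is a horizontal leaf of `R`. -/
def IsHorizontalSubrectangle (H R : Rectangle M) : Prop :=
  H.carrier ⊆ R.carrier ∧
    ∀ t ∈ Ioo (0 : ℝ) 1, ∃ t' ∈ Icc (0 : ℝ) 1, H.horizontalLeaf t = R.horizontalLeaf t'

/-- `V` is a vertical sub-rectangle of `R`: it is contained in `R`, and the vertical leaf of
`V` through any interior point of `V` is a vertical leaf of `R`. -/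
def IsVerticalSubrectangle (V R : Rectangle M) : Prop :=
  V.carrier ⊆ R.carrier ∧
    ∀ s ∈ Ioo (0 : ℝ) 1, ∃ s' ∈ Icc (0 : ℝ) 1, V.verticalLeaf s = R.verticalLeaf s'

end Rectangle

/-- A geometric Markov partition `R_0, …, R_{n-1}` for `f`. Each nonempty connected component of
`int R_i ∩ f⁻¹ (int R_j)` is the interior of a horizontal sub-rectangle of `R_i`, and each
nonempty connected component of `f (int R_i) ∩ int R_j` is the interior of a vertical
sub-rectangle of `R_j`. (A rectangle is the closure of its interior.) -/
structure MarkovPartition (M : TransverseFoliations S) (f : S ≃ₜ S) (n : ℕ) where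
  rect : Fin n → Rectangle M
  cover : ⋃ i, (rect i).carrier = univ
  disjoint : ∀ i j, i ≠ j → Disjoint (rect i).inner (rect j).inner
  horizontal : ∀ i j, ∀ x ∈ (rect i).inner ∩ f ⁻¹' (rect j).inner,
    ∃ H : Rectangle M, H.inner = connectedComponentIn ((rect i).inner ∩ f ⁻¹' (rect j).inner) x ∧
      H.IsHorizontalSubrectangle (rect i)
  vertical : ∀ i j, ∀ x ∈ f '' (rect i).inner ∩ (rect j).inner,
    ∃ V : Rectangle M, V.inner = connectedComponentIn (f '' (rect i).inner ∩ (rect j).inner) x ∧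
      V.IsVerticalSubrectangle (rect j)

/-- The space of bi-infinite words all of whose transitions have coefficient `1` in `A`, with the
topology induced by the product topology. -/
def Subshift {n : ℕ} (A : Matrix (Fin n) (Fin n) ℕ∞) : Type :=
  {w : ℤ → Fin n // ∀ z, A (w z) (w (z + 1)) = 1}

instance {n : ℕ} (A : Matrix (Fin n) (Fin n) ℕ∞) : TopologicalSpace (Subshift A) :=
  inferInstanceAs (TopologicalSpace {w : ℤ → Fin n // ∀ z, A (w z) (w (z + 1)) = 1})

/-- The shift map on the subshift. -/
def Subshift.shift {n : ℕ} {A : Matrix (Fin n) (Fin n) ℕ∞} (w : Subshift A) : Subshift A :=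
  ⟨fun z => w.1 (z + 1), fun z => w.2 (z + 1)⟩

/-- All coefficients are `0` or `1`. -/
def IsBinary {n : ℕ} (A : Matrix (Fin n) (Fin n) ℕ∞) : Prop := ∀ i k, A i k = 0 ∨ A i k = 1

namespace MarkovPartition

variable {M : TransverseFoliations S} {f : S ≃ₜ S} {n : ℕ} (R : MarkovPartition M f n)

/-- The horizontal sub-rectangles of the Markov partition contained in `R_i`. -/
def horizontalSubrectangles (i : Fin n) : Set (Set S) :=
  {H | ∃ j, ∃ x ∈ (R.rect i).inner ∩ f ⁻¹' (R.rect j).inner,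
    H = closure (connectedComponentIn ((R.rect i).inner ∩ f ⁻¹' (R.rect j).inner) x)}

/-- The vertical sub-rectangles of the Markov partition contained in `R_k`. -/
def verticalSubrectangles (k : Fin n) : Set (Set S) :=
  {V | ∃ i, ∃ x ∈ f '' (R.rect i).inner ∩ (R.rect k).inner,
    V = closure (connectedComponentIn (f '' (R.rect i).inner ∩ (R.rect k).inner) x)}

/-- The incidence matrix: `a_{ik}` is the number of horizontal sub-rectangles of `R_i` that `f`
maps to vertical sub-rectangles of `R_k`. (The numbers are finite; `ℕ∞` avoids having to prove
this for the definition.) -/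
noncomputable def incidenceMatrix : Matrix (Fin n) (Fin n) ℕ∞ := fun i k =>
  {H | H ∈ R.horizontalSubrectangles i ∧ f '' H ∈ R.verticalSubrectangles k}.encard

/-- The set `⋂_m closure (⋂_{-m ≤ z ≤ m} f^{-z} (int R_{w_z}))` attached to a word `w`. -/
def projectionSet (w : ℤ → Fin n) : Set S :=
  ⋂ m : ℕ, closure (⋂ z ∈ Icc (-(m : ℤ)) (m : ℤ), (f ^ z : S ≃ₜ S) ⁻¹' (R.rect (w z)).inner)

/-- `w` is a code of the sector `e_j(x)`: for each `z`, the sector `f^z (e_j(x))` is contained in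
the rectangle with index `w z`. -/
def IsSectorCode (x : S) (j : Fin (2 * M.prongs x)) (w : ℤ → Fin n) : Prop :=
  ∀ z : ℤ, SectorContainedIn (mapSector (f ^ z : S ≃ₜ S) (M.sector x j)) (R.rect (w z)).carrier

end MarkovPartition

end Basic

end PseudoAnosov

/-!
Write `w` for the local coordinate at a point `p`, so that `w ^ 2 = z ^ k`. The number `|Im w|` is
single-valued (`TransverseFoliations.height`), and on overlaps of charts it changes by a translation
followed by an absolute value (`height_compat`). It is constant along stable leaves, and along an
injective unstable path its increments add up to a length (`IsUnstablePath.exists_isLength`). In a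
rectangle this length can be transported along the horizontal leaves, so the vertical coordinate can
be measured by one strictly monotone continuous function (`Rectangle.exists_isHeightFunction`).
Everything said about the stable direction also holds for the unstable one: exchanging the two
foliations, the two directions of the rectangles, and `f` with `f⁻¹` gives again a Markov partition
(`MarkovPartition.dual`).

A coefficient of the incidence matrix is nonzero if and only if the open set
`crossing i j = int R_i ∩ f⁻¹ (int R_j)` is nonempty, and it is at most `1` only if this set is
connected. The crossing is a union of full horizontal leaves of `R_i`, and its image is a union of
full vertical leaves of `R_j`. Hence all cylinders of an admissible word are nonempty
(`cylinder_nonempty_and_saturated`). As `f` multiplies differences of heights on a connected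
crossing by `lam` (`Rectangle.abs_height_map`), the heights of the forward cylinders, and by duality
the widths of the backward ones, tend to `0`. So the closures of the two-sided cylinders shrink to a
point (`exists_projectionSet_eq_singleton`).

For the sectors, the sides of the rectangles are injective paths in leaves; therefore, close to any
point `p`, they lie on the separatrices of `p`. A small sector is connected and avoids the
separatrices, and `f` preserves `Im (w ^ 2)`; hence every iterate of a small sector lies in the
interior of a single rectangle (`exists_eventually_mem_inner`). This gives each sector exactly one
code. Its cylinders accumulate at `x`, so it projects to `x`. Conversely, if `w` projects to `x`,
its cylinders are open sets accumulating at `x`, and they meet one of the finitely many sectors; the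
code of that sector is `w` (`exists_eq_of_mem_projectionSet`).
-/

namespace PseudoAnosov

variable {S : Type*} [TopologicalSpace S]

/-! ### The transverse coordinate of the stable foliation -/

namespace TransverseFoliations

variable (M : TransverseFoliations S)

/-- The square `z ^ k` of the local coordinate `w` at `p`, evaluated at `x`. Unlike `w`, it is
single-valued. -/
noncomputable def form (p x : S) : ℂ := M.chart p x ^ M.prongs p

/-- The absolute value `|Im w|` at `x` of the transverse coordinate of the stable foliation in the
chart at `p`, written in terms of `w ^ 2`. -/
noncomputable def height (p x : S) : ℝ := √((‖M.form p x‖ - (M.form p x).re) / 2)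

lemma height_eq_abs_im {p x : S} {w : ℂ} (h : w ^ 2 = M.form p x) : M.height p x = |w.im| := by
  have h1 : ‖w ^ 2‖ = w.re * w.re + w.im * w.im := by
    rw [norm_pow, ← Complex.normSq_eq_norm_sq, Complex.normSq_apply]
  have h2 : (w ^ 2).re = w.re * w.re - w.im * w.im := by rw [pow_two, Complex.mul_re]
  rw [height, ← h, h1, h2, ← Real.sqrt_sq_eq_abs]
  congr 1
  ring

lemma height_nonneg (p x : S) : 0 ≤ M.height p x := Real.sqrt_nonneg _

lemma form_self (p : S) : M.form p p = 0 := by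
  rw [form, M.chart_self, zero_pow (by have := M.prongs_pos p; omega)]

lemma height_self (p : S) : M.height p p = 0 := by simp [height, form_self]

lemma form_eq_zero_iff {p x : S} (hx : x ∈ (M.chart p).source) : M.form p x = 0 ↔ x = p := by
  constructor
  · intro h
    refine (M.chart p).injOn hx (M.mem_source p) ?_
    rw [M.chart_self]
    exact pow_eq_zero_iff (by have := M.prongs_pos p; omega) |>.1 h
  · rintro rfl
    exact M.form_self x

lemma continuousOn_form (p : S) : ContinuousOn (M.form p) (M.chart p).source :=
  (M.chart p).continuousOn.pow _

lemma continuousOn_height (p : S) : ContinuousOn (M.height p) (M.chart p).source := by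
  have h := M.continuousOn_form p
  exact Real.continuous_sqrt.comp_continuousOn
    ((h.norm.sub (Complex.continuous_re.comp_continuousOn h)).div_const 2)

lemma source_mem_nhds (p : S) : (M.chart p).source ∈ 𝓝 p :=
  (M.chart p).open_source.mem_nhds (M.mem_source p)

lemma continuousAt_height_self (p : S) : ContinuousAt (M.height p) p :=
  (M.continuousOn_height p).continuousAt (M.source_mem_nhds p)

lemma height_eq_zero_of_mem_stablePlaque {p x : S} (h : x ∈ M.stablePlaque p) :
    M.height p x = 0 := by
  obtain ⟨-, r, hr, h⟩ := h
  simp [height, form, h, abs_of_nonneg hr]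

lemma form_eq_of_mem_unstablePlaque {p x : S} (h : x ∈ M.unstablePlaque p) :
    M.form p x = -((M.height p x ^ 2 : ℝ) : ℂ) := by
  obtain ⟨-, r, hr, h⟩ := h
  have h1 : M.form p x = -(r : ℂ) := h
  have h2 : M.height p x ^ 2 = r := by
    rw [height, Real.sq_sqrt] <;> simp [h1, abs_of_nonneg hr, hr]
  rw [h1, h2]

lemma height_eq_zero_iff_of_mem_unstablePlaque {p x : S} (h : x ∈ M.unstablePlaque p) :
    M.height p x = 0 ↔ x = p := by
  rw [← M.form_eq_zero_iff h.1, M.form_eq_of_mem_unstablePlaque h]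
  simp

lemma im_form_eq_zero_of_mem_stablePlaque {p x : S} (h : x ∈ M.stablePlaque p) :
    (M.form p x).im = 0 := by
  obtain ⟨-, r, hr, h⟩ := h
  simp [form, h]

lemma im_form_eq_zero_of_mem_unstablePlaque {p x : S} (h : x ∈ M.unstablePlaque p) :
    (M.form p x).im = 0 := by
  obtain ⟨-, r, hr, h⟩ := h
  simp [form, h]

/-- Compatibility of the charts, in terms of the transverse coordinate: the coordinates `Im w` at
`p` and at `q` differ by a sign and a translation, and `Im w` vanishes at `q` in the chart at
`q`. -/
lemma height_compat {p q : S} (hq : q ∈ (M.chart p).source) :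
    ∀ᶠ x in 𝓝 q, M.height q x = |M.height p x - M.height p q| := by
  by_cases hqp : q = p
  · subst hqp
    refine Eventually.of_forall fun x => ?_
    rw [height_self, sub_zero, abs_of_nonneg (M.height_nonneg _ _)]
  obtain ⟨hk, c, hc⟩ := M.compat p q hq hqp
  have hq0 : M.height p q = |c.im| := by
    apply M.height_eq_abs_im
    have := hc.self_of_nhds
    rwa [M.chart_self, zero_add] at this
  have hcont : Tendsto (fun x => |(M.chart q x).im|) (𝓝 q) (𝓝 0) := by
    have h1 : ContinuousAt (M.chart q) q := (M.chart q).continuousAt (M.mem_source q)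
    have h2 : ContinuousAt (fun x => |(M.chart q x).im|) q :=
      (Complex.continuous_im.continuousAt.comp h1).abs
    simpa [ContinuousAt, M.chart_self] using h2
  have hsmall : ∀ᶠ x in 𝓝 q, c.im = 0 ∨ |(M.chart q x).im| < |c.im| := by
    by_cases h0 : c.im = 0
    · exact Eventually.of_forall fun x => Or.inl h0
    · exact (hcont.eventually_lt_const (abs_pos.2 h0)).mono fun x hx => Or.inr hx
  filter_upwards [hc, hsmall] with x hx hs
  have h1 : M.height q x = |(M.chart q x).im| :=
    M.height_eq_abs_im (by rw [form, hk])
  have h2 : M.height p x = |(M.chart q x).im + c.im| := by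
    simpa using M.height_eq_abs_im hx
  rw [h1, h2, hq0]
  rcases hs with hs | hs
  · simp [hs]
  · obtain ⟨hs1, hs2⟩ := abs_lt.1 hs
    rcases abs_cases c.im with ⟨h, h'⟩ | ⟨h, h'⟩
    · rw [h] at hs1 hs2 ⊢
      rw [abs_of_nonneg (by linarith : 0 ≤ (M.chart q x).im + c.im)]
      congr 1
      ring
    · rw [h] at hs1 hs2 ⊢
      rw [abs_of_nonpos (by linarith : (M.chart q x).im + c.im ≤ 0), ← abs_neg]
      congr 1
      ring

/-- The transverse coordinate is constant along stable paths inside a chart. -/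
lemma IsStablePath.height_eq {M : TransverseFoliations S} {γ : ℝ → S} (hγ : M.IsStablePath γ)
    {p : S} {J : Set ℝ} (hJ : IsPreconnected J) (hJ01 : J ⊆ Icc 0 1)
    (hJp : MapsTo γ J (M.chart p).source) {t t' : ℝ} (ht : t ∈ J) (ht' : t' ∈ J) :
    M.height p (γ t) = M.height p (γ t') := by
  refine hJ.induction₂ (fun t t' => M.height p (γ t) = M.height p (γ t')) ?_
    (fun _ _ _ _ _ _ h h' => h.trans h') (fun _ _ _ _ h => h.symm) ht ht'
  intro u hu
  have h1 : ∀ᶠ t in 𝓝[J] u, γ t ∈ M.stablePlaque (γ u) :=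
    nhdsWithin_mono _ hJ01 (hγ.2 u (hJ01 hu))
  have h2 := ((hγ.1 u (hJ01 hu)).mono hJ01).eventually (M.height_compat (hJp hu))
  filter_upwards [h1, h2] with t h1 h2
  rw [M.height_eq_zero_of_mem_stablePlaque h1] at h2
  linarith [abs_eq_zero.1 h2.symm]

/-! ### Length along unstable paths -/

/-- Along one local unstable separatrix, the transverse coordinate is injective. -/
lemma height_comp_injOn {M : TransverseFoliations S} {γ : ℝ → S} {p : S} {J : Set ℝ}
    (hJ : IsPreconnected J) (hc : ContinuousOn γ J) (hi : InjOn γ J)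
    (hm : MapsTo γ J (M.unstablePlaque p)) (hp : ∀ t ∈ J, γ t ≠ p) :
    InjOn (fun t => M.height p (γ t)) J := by
  have hk : M.prongs p ≠ 0 := by have := M.prongs_pos p; omega
  have hz : ContinuousOn (fun t => M.chart p (γ t)) J :=
    (M.chart p).continuousOn.comp hc fun t ht => (hm ht).1
  have hz0 : ∀ t ∈ J, M.chart p (γ t) ≠ 0 := fun t ht h =>
    hp t ht ((M.form_eq_zero_iff (hm ht).1).1 (by rw [form, h, zero_pow hk]))
  have hfin : {u : ℂ | u ^ M.prongs p = -1}.Finite := by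
    refine (Polynomial.nthRoots (M.prongs p) (-1 : ℂ)).toFinset.finite_toSet.subset ?_
    intro u hu
    simpa [Polynomial.mem_nthRoots (Nat.pos_of_ne_zero hk)] using hu
  have hnorm : ∀ t ∈ J, ‖M.chart p (γ t)‖ ^ M.prongs p = M.height p (γ t) ^ 2 := by
    intro t ht
    have := congrArg norm (M.form_eq_of_mem_unstablePlaque (hm ht))
    rwa [form, norm_pow, norm_neg, Complex.norm_real, Real.norm_eq_abs, abs_sq] at this
  -- The direction `z / ‖z‖` varies continuously in the finite set of `k`-th roots of `-1`.
  have hu : ContinuousOn (fun t => M.chart p (γ t) / (‖M.chart p (γ t)‖ : ℂ)) J :=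
    hz.div (Complex.continuous_ofReal.comp_continuousOn hz.norm) fun t ht => by
      simpa using hz0 t ht
  have hmaps : MapsTo (fun t => M.chart p (γ t) / (‖M.chart p (γ t)‖ : ℂ)) J
      {u : ℂ | u ^ M.prongs p = -1} := by
    intro t ht
    have h0 : (‖M.chart p (γ t)‖ : ℂ) ≠ 0 := by simpa using hz0 t ht
    have h1 := M.form_eq_of_mem_unstablePlaque (hm ht)
    rw [← hnorm t ht] at h1
    rw [mem_ofPred_eq, div_pow, div_eq_iff (pow_ne_zero _ h0)]
    rw [form] at h1
    rw [h1]
    push_cast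
    ring
  intro t ht t' ht' heq
  have hdir := hJ.constant_of_mapsTo hfin.isDiscrete hu hmaps ht ht'
  have hn : ‖M.chart p (γ t)‖ = ‖M.chart p (γ t')‖ := by
    refine (pow_left_inj₀ (norm_nonneg _) (norm_nonneg _) hk).1 ?_
    simp only at heq
    rw [hnorm t ht, hnorm t' ht', heq]
  simp only [hn] at hdir
  have h0 : (‖M.chart p (γ t')‖ : ℂ) ≠ 0 := by simpa using hz0 t' ht'
  exact hi ht ht' ((M.chart p).injOn (hm ht).1 (hm ht').1 ((div_left_inj' h0).1 hdir))

/-- `Φ` measures the length along the path `γ` with respect to the transverse measure of the stable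
foliation: near each parameter, its increments are those of the transverse coordinate. -/
def IsLength (M : TransverseFoliations S) (γ : ℝ → S) (J : Set ℝ) (Φ : ℝ → ℝ) : Prop :=
  StrictMonoOn Φ J ∧ ∀ t₀ ∈ J, ∀ᶠ t in 𝓝[J] t₀, |Φ t - Φ t₀| = M.height (γ t₀) (γ t)

lemma IsLength.mono {M : TransverseFoliations S} {γ : ℝ → S} {J J' : Set ℝ} {Φ : ℝ → ℝ}
    (h : M.IsLength γ J Φ) (hJ : J' ⊆ J) : M.IsLength γ J' Φ :=
  ⟨h.1.mono hJ, fun t ht => nhdsWithin_mono _ hJ (h.2 t (hJ ht))⟩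

lemma IsLength.glue {M : TransverseFoliations S} {γ : ℝ → S} {a b c : ℝ} (hab : a ≤ b)
    (hbc : b ≤ c) {Φ Ψ : ℝ → ℝ} (h : M.IsLength γ (Icc a b) Φ) (h' : M.IsLength γ (Icc b c) Ψ) :
    ∃ Θ, M.IsLength γ (Icc a c) Θ := by
  let Θ : ℝ → ℝ := fun t => if t ≤ b then Φ t else Ψ t - Ψ b + Φ b
  have e1 : ∀ t ∈ Icc a b, Θ t = Φ t := fun t ht => if_pos ht.2
  have e2 : ∀ t ∈ Icc b c, Θ t = Ψ t - Ψ b + Φ b := by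
    intro t ht
    rcases ht.1.eq_or_lt with rfl | hlt
    · simp [Θ]
    · exact if_neg (not_le.2 hlt)
  refine ⟨Θ, ?_, ?_⟩
  · rw [← Icc_union_Icc_eq_Icc hab hbc]
    refine StrictMonoOn.union (c := b) ?_ ?_ (isGreatest_Icc hab) (isLeast_Icc hbc)
    · intro x hx y hy hxy
      rw [e1 x hx, e1 y hy]
      exact h.1 hx hy hxy
    · intro x hx y hy hxy
      rw [e2 x hx, e2 y hy]
      linarith [h'.1 hx hy hxy]
  · intro t₀ _
    rw [← Icc_union_Icc_eq_Icc hab hbc, nhdsWithin_union, eventually_sup]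
    constructor
    · by_cases ht : t₀ ∈ Icc a b
      · filter_upwards [h.2 t₀ ht, self_mem_nhdsWithin] with t h1 h2
        rw [e1 t h2, e1 t₀ ht, h1]
      · rw [notMem_closure_iff_nhdsWithin_eq_bot.1 (by rwa [isClosed_Icc.closure_eq])]
        exact eventually_bot
    · by_cases ht : t₀ ∈ Icc b c
      · filter_upwards [h'.2 t₀ ht, self_mem_nhdsWithin] with t h1 h2
        rw [e2 t h2, e2 t₀ ht, ← h1]
        congr 1
        ring
      · rw [notMem_closure_iff_nhdsWithin_eq_bot.1 (by rwa [isClosed_Icc.closure_eq])]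
        exact eventually_bot

/-- A short injective unstable path has a length function: the transverse coordinate at its
base point, with a sign that changes at the base point. -/
lemma exists_isLength_of_subset_plaque {M : TransverseFoliations S} {γ : ℝ → S} {a b t₀ : ℝ}
    (ht₀ : t₀ ∈ Icc a b) (hc : ContinuousOn γ (Icc a b)) (hi : InjOn γ (Icc a b))
    (hm : MapsTo γ (Icc a b) (M.unstablePlaque (γ t₀))) :
    ∃ Φ, M.IsLength γ (Icc a b) Φ := by
  set p := γ t₀ with hp
  set g : ℝ → ℝ := fun t => M.height p (γ t) with hg
  have hgc : ContinuousOn g (Icc a b) :=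
    (M.continuousOn_height p).comp hc fun t ht => (hm ht).1
  have hg0 : g t₀ = 0 := M.height_self p
  have hgp : ∀ t ∈ Icc a b, g t = 0 ↔ t = t₀ := by
    intro t ht
    rw [hg, M.height_eq_zero_iff_of_mem_unstablePlaque (hm ht)]
    exact ⟨fun h => hi ht ht₀ h, fun h => by rw [h]⟩
  have hside : ∀ J ⊆ Icc a b, IsPreconnected (J \ {t₀}) → InjOn g J := by
    intro J hJ hpre t ht t' ht' heq
    by_cases h : t = t₀
    · subst h
      exact ((hgp t' (hJ ht')).1 (heq ▸ hg0)).symm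
    by_cases h' : t' = t₀
    · subst h'
      exact (hgp t (hJ ht)).1 (heq ▸ hg0)
    · have hJ' : J \ {t₀} ⊆ Icc a b := sdiff_subset.trans hJ
      refine height_comp_injOn hpre (hc.mono hJ') (hi.mono hJ') (hm.mono_left hJ') ?_
        ⟨ht, h⟩ ⟨ht', h'⟩ heq
      intro u hu hup
      exact hu.2 (hi (hJ' hu) ht₀ hup)
  have hR : StrictMonoOn g (Icc t₀ b) := by
    refine ContinuousOn.strictMonoOn_of_injOn_Icc ht₀.2 (by rw [hg0]; exact M.height_nonneg _ _)
      (hgc.mono (Icc_subset_Icc_left ht₀.1)) (hside _ (Icc_subset_Icc_left ht₀.1) ?_)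
    rw [Icc_sdiff_left]
    exact isPreconnected_Ioc
  have hL : StrictAntiOn g (Icc a t₀) := by
    refine ContinuousOn.strictAntiOn_of_injOn_Icc ht₀.1 (by rw [hg0]; exact M.height_nonneg _ _)
      (hgc.mono (Icc_subset_Icc_right ht₀.2)) (hside _ (Icc_subset_Icc_right ht₀.2) ?_)
    rw [Icc_sdiff_right]
    exact isPreconnected_Ico
  have hloc : ∀ t₁ ∈ Icc a b, ∀ᶠ t in 𝓝[Icc a b] t₁, |g t - g t₁| = M.height (γ t₁) (γ t) := by
    intro t₁ ht₁
    filter_upwards [(hc t₁ ht₁).eventually (M.height_compat (hm ht₁).1)] with t h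
    rw [h]
  refine IsLength.glue (Φ := fun t => -g t) (Ψ := g) ht₀.1 ht₀.2 ⟨hL.neg, ?_⟩ ⟨hR, ?_⟩
  · intro t₁ ht₁
    filter_upwards [nhdsWithin_mono _ (Icc_subset_Icc_right ht₀.2)
      (hloc t₁ ⟨ht₁.1, ht₁.2.trans ht₀.2⟩)] with t h
    rw [← h, ← abs_neg]
    congr 1
    ring
  · intro t₁ ht₁
    exact nhdsWithin_mono _ (Icc_subset_Icc_left ht₀.1) (hloc t₁ ⟨ht₀.1.trans ht₁.1, ht₁.2⟩)

/-- Every injective unstable path has a length function. -/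
theorem IsUnstablePath.exists_isLength {M : TransverseFoliations S} {γ : ℝ → S}
    (hγ : M.IsUnstablePath γ) (hi : InjOn γ (Icc 0 1)) : ∃ Φ, M.IsLength γ (Icc 0 1) Φ := by
  suffices h : ∃ Φ, M.IsLength γ (uIcc 0 1) Φ by rwa [uIcc_of_le zero_le_one] at h
  refine isPreconnected_Icc.induction₂ (s := Icc (0 : ℝ) 1)
    (fun a b => ∃ Φ, M.IsLength γ (uIcc a b) Φ) ?_ ?_ ?_
    (left_mem_Icc.2 zero_le_one) (right_mem_Icc.2 zero_le_one)
  · intro t₀ ht₀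
    obtain ⟨ε, hε, hball⟩ := Metric.mem_nhdsWithin_iff.1 (hγ.2 t₀ ht₀)
    filter_upwards [self_mem_nhdsWithin, mem_nhdsWithin_of_mem_nhds (Metric.ball_mem_nhds t₀ hε)]
      with t ht ht'
    have hsub : uIcc t₀ t ⊆ Metric.ball t₀ ε ∩ Icc 0 1 := by
      intro u hu
      refine ⟨?_, ordConnected_Icc.uIcc_subset ht₀ ht hu⟩
      exact (convex_ball t₀ ε).ordConnected.uIcc_subset (Metric.mem_ball_self hε) ht' hu
    exact exists_isLength_of_subset_plaque (t₀ := t₀) left_mem_uIcc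
      (hγ.1.mono fun u hu => (hsub hu).2) (hi.mono fun u hu => (hsub hu).2)
      fun u hu => hball (hsub hu)
  · rintro a b c - - - ⟨Φ, hΦ⟩ ⟨Ψ, hΨ⟩
    have key : ∀ a b c : ℝ, ∀ Φ Ψ, a ≤ c → M.IsLength γ (uIcc a b) Φ →
        M.IsLength γ (uIcc b c) Ψ → ∃ Θ, M.IsLength γ (uIcc a c) Θ := by
      intro a b c Φ Ψ hac hΦ hΨ
      rcases le_total a b with hab | hab
      · rcases le_total b c with hbc | hbc
        · rw [uIcc_of_le hab] at hΦ
          rw [uIcc_of_le hbc] at hΨ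
          rw [uIcc_of_le hac]
          exact hΦ.glue hab hbc hΨ
        · exact ⟨Φ, hΦ.mono (uIcc_subset_uIcc left_mem_uIcc (by
            rw [uIcc_of_le hab]; exact ⟨hac, hbc⟩))⟩
      · exact ⟨Ψ, hΨ.mono (uIcc_subset_uIcc (by
          rw [uIcc_of_le (hab.trans hac)]; exact ⟨hab, hac⟩) right_mem_uIcc)⟩
    rcases le_total a c with hac | hac
    · exact key a b c Φ Ψ hac hΦ hΨ
    · rw [uIcc_comm] at hΦ hΨ ⊢
      exact key c b a Ψ Φ hac hΨ hΦ
  · rintro a b - - ⟨Φ, hΦ⟩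
    exact ⟨Φ, by rwa [uIcc_comm]⟩

lemma IsLength.continuousOn {M : TransverseFoliations S} {γ : ℝ → S} {J : Set ℝ} {Φ : ℝ → ℝ}
    (h : M.IsLength γ J Φ) (hγ : ContinuousOn γ J) : ContinuousOn Φ J := by
  intro t₀ ht₀
  have h1 : Tendsto (fun t => M.height (γ t₀) (γ t)) (𝓝[J] t₀) (𝓝 0) := by
    have := (M.continuousAt_height_self (γ t₀)).tendsto.comp (hγ t₀ ht₀)
    rwa [height_self] at this
  rw [ContinuousWithinAt, tendsto_iff_dist_tendsto_zero]
  exact h1.congr' ((h.2 t₀ ht₀).mono fun t ht => by simp only [Real.dist_eq, ht])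

end TransverseFoliations

/-! ### Exchanging the stable and the unstable foliation -/

/-- The homeomorphism `z ↦ conj (exp (i π / k) z)` of the plane. -/
noncomputable def dualHomeomorph (k : ℕ) : ℂ ≃ₜ ℂ :=
  (Homeomorph.mulLeft₀ (Complex.exp ((Real.pi / k : ℝ) * Complex.I)) (Complex.exp_ne_zero _)).trans
    Complex.conjCLE.toHomeomorph

lemma dualHomeomorph_apply (k : ℕ) (z : ℂ) :
    dualHomeomorph k z =
      (starRingEnd ℂ) (Complex.exp ((Real.pi / k : ℝ) * Complex.I) * z) := rfl

lemma dualHomeomorph_pow {k : ℕ} (hk : k ≠ 0) (z : ℂ) :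
    dualHomeomorph k z ^ k = (starRingEnd ℂ) (-z ^ k) := by
  have h : Complex.exp ((Real.pi / k : ℝ) * Complex.I) ^ k = -1 := by
    rw [← Complex.exp_nat_mul, ← Complex.exp_pi_mul_I]
    congr 1
    have : (k : ℂ) ≠ 0 := by exact_mod_cast hk
    push_cast
    field_simp
  rw [dualHomeomorph_apply, ← map_pow, mul_pow, h]
  congr 1
  ring

namespace TransverseFoliations

variable (M : TransverseFoliations S)

/-- The same pair of foliations with the stable and the unstable one exchanged. The charts are
rotated by `π / k`, which exchanges the separatrices, and then reflected; the effect on the local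
coordinate `w` is to exchange its real and imaginary parts. The orientation of the surface is
reversed. -/
noncomputable def dual : TransverseFoliations S where
  prongs := M.prongs
  prongs_pos := M.prongs_pos
  chart p := (M.chart p).transHomeomorph (dualHomeomorph (M.prongs p))
  mem_source p := M.mem_source p
  chart_self p := by
    change dualHomeomorph _ (M.chart p p) = 0
    rw [M.chart_self, dualHomeomorph_apply, mul_zero, map_zero]
  compat p q hq hqp := by
    obtain ⟨hk, c, hc⟩ := M.compat p q hq hqp
    refine ⟨hk, dualHomeomorph 2 c, ?_⟩
    filter_upwards [hc] with x hx
    change (dualHomeomorph _ (M.chart q x) + _) ^ 2 = dualHomeomorph _ (M.chart p x) ^ _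
    have hp := M.prongs_pos p
    rw [dualHomeomorph_pow (by omega), ← hx, hk]
    have : dualHomeomorph 2 (M.chart q x) + dualHomeomorph 2 c
        = dualHomeomorph 2 (M.chart q x + c) := by
      simp only [dualHomeomorph_apply, mul_add, map_add]
    rw [this, dualHomeomorph_pow two_ne_zero]

lemma form_dual (p x : S) : M.dual.form p x = (starRingEnd ℂ) (-M.form p x) :=
  dualHomeomorph_pow (by have := M.prongs_pos p; omega) _

lemma stablePlaque_dual (p : S) : M.dual.stablePlaque p = M.unstablePlaque p := by
  ext x
  refine and_congr Iff.rfl (exists_congr fun r => and_congr Iff.rfl ?_)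
  change M.dual.form p x = r ↔ M.form p x = -(r : ℂ)
  rw [form_dual, ← Complex.conj_ofReal r, (starRingEnd ℂ).injective.eq_iff, neg_eq_iff_eq_neg,
    Complex.conj_ofReal]

lemma unstablePlaque_dual (p : S) : M.dual.unstablePlaque p = M.stablePlaque p := by
  ext x
  refine and_congr Iff.rfl (exists_congr fun r => and_congr Iff.rfl ?_)
  change M.dual.form p x = -(r : ℂ) ↔ M.form p x = r
  rw [form_dual, ← Complex.conj_ofReal r, ← map_neg, (starRingEnd ℂ).injective.eq_iff, neg_inj,
    Complex.conj_ofReal]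

lemma isStablePath_dual {γ : ℝ → S} : M.dual.IsStablePath γ ↔ M.IsUnstablePath γ := by
  simp only [IsStablePath, IsUnstablePath, stablePlaque_dual]

lemma isUnstablePath_dual {γ : ℝ → S} : M.dual.IsUnstablePath γ ↔ M.IsStablePath γ := by
  simp only [IsStablePath, IsUnstablePath, unstablePlaque_dual]

end TransverseFoliations

lemma IsPseudoAnosov.dual {M : TransverseFoliations S} {f : S ≃ₜ S} (hf : IsPseudoAnosov M f) :
    IsPseudoAnosov M.dual f.symm := by
  obtain ⟨lam, hlam, h⟩ := hf
  refine ⟨lam, hlam, fun p => ?_⟩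
  obtain ⟨hk, he⟩ := h (f.symm p)
  rw [f.apply_symm_apply] at hk he
  refine ⟨hk.symm, ?_⟩
  have h1 : Tendsto f.symm (𝓝 p) (𝓝 (f.symm p)) := f.symm.continuous.continuousAt
  filter_upwards [h1.eventually he] with x ⟨w, hw, hw'⟩
  rw [f.apply_symm_apply] at hw'
  have hl : lam ≠ 0 := by positivity
  have hswap : ∀ a b : ℝ, ∀ ζ : ℂ, (⟨a, b⟩ : ℂ) ^ 2 = ζ →
      (⟨b, a⟩ : ℂ) ^ 2 = (starRingEnd ℂ) (-ζ) := by
    rintro a b ζ rfl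
    apply Complex.ext <;> simp [pow_two, Complex.mul_re, Complex.mul_im]
  refine ⟨⟨lam * w.im, lam⁻¹ * w.re⟩, ?_, ?_⟩
  · refine (hswap (lam⁻¹ * w.re) (lam * w.im) _ hw').trans ?_
    exact (M.form_dual p x).symm
  · have h2 : stretch lam ⟨lam * w.im, lam⁻¹ * w.re⟩ = ⟨w.im, w.re⟩ := by
      apply Complex.ext <;> simp [stretch, hl]
    rw [h2]
    refine (hswap w.re w.im _ hw).trans ?_
    exact (M.form_dual (f.symm p) (f.symm x)).symm

/-- `g` multiplies the transverse coordinate of the stable foliation by `c`. -/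
def ScalesHeight (M : TransverseFoliations S) (g : S → S) (c : ℝ) : Prop :=
  ∀ p, ∀ᶠ x in 𝓝 p, M.height (g p) (g x) = c * M.height p x

lemma IsPseudoAnosov.exists_height_map {M : TransverseFoliations S} {f : S ≃ₜ S}
    (hf : IsPseudoAnosov M f) :
    ∃ lam : ℝ, 1 < lam ∧ ScalesHeight M f lam := by
  obtain ⟨lam, hlam, h⟩ := hf
  refine ⟨lam, hlam, fun p => (h p).2.mono fun x ⟨w, hw, hw'⟩ => ?_⟩
  rw [M.height_eq_abs_im hw, M.height_eq_abs_im hw', stretch, abs_mul, abs_of_pos (by linarith)]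

/-- A pseudo-Anosov homeomorphism preserves the product `Re w * Im w`, hence the germs of the
union of the separatrices. -/
lemma IsPseudoAnosov.im_form_map {M : TransverseFoliations S} {f : S ≃ₜ S}
    (hf : IsPseudoAnosov M f) (p : S) :
    ∀ᶠ x in 𝓝 p, (M.form (f p) (f x)).im = (M.form p x).im := by
  obtain ⟨lam, hlam, h⟩ := hf
  have hl : lam ≠ 0 := by positivity
  refine (h p).2.mono fun x ⟨w, hw, hw'⟩ => ?_
  rw [TransverseFoliations.form, TransverseFoliations.form, ← hw, ← hw']
  simp only [stretch, pow_two, Complex.mul_im]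
  field_simp

/-! ### Rectangles -/

/-- The open unit square. -/
abbrev openSquare : Set (ℝ × ℝ) := Ioo 0 1 ×ˢ Ioo 0 1

/-- The closed unit square. -/
abbrev closedSquare : Set (ℝ × ℝ) := Icc 0 1 ×ˢ Icc 0 1

lemma isOpen_openSquare : IsOpen openSquare := isOpen_Ioo.prod isOpen_Ioo

lemma openSquare_subset : openSquare ⊆ closedSquare :=
  prod_mono Ioo_subset_Icc_self Ioo_subset_Icc_self

lemma closure_openSquare : closure openSquare = closedSquare := by
  rw [closure_prod_eq, closure_Ioo zero_ne_one]

namespace Rectangle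

variable {M : TransverseFoliations S} (R : Rectangle M)

lemma continuousAt_param {a : ℝ × ℝ} (ha : a ∈ openSquare) : ContinuousAt R.param a :=
  R.continuousOn.continuousAt
    (mem_of_superset (isOpen_openSquare.mem_nhds ha) openSquare_subset)

lemma isOpen_inner : IsOpen R.inner := R.isOpen_image _ Subset.rfl isOpen_openSquare

lemma inner_subset_carrier : R.inner ⊆ R.carrier := image_mono openSquare_subset

lemma carrier_subset_closure_inner : R.carrier ⊆ closure R.inner := by
  have h : ContinuousOn R.param (closure openSquare) := by
    rw [closure_openSquare]
    exact R.continuousOn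
  have h' := h.image_closure
  rwa [closure_openSquare] at h'

lemma isCompact_carrier : IsCompact R.carrier :=
  (isCompact_Icc.prod isCompact_Icc).image_of_continuousOn R.continuousOn

/-- The sides of a rectangle are disjoint from its interior. -/
lemma mem_openSquare_of_param_mem_inner {a : ℝ × ℝ} (ha : a ∈ closedSquare)
    (h : R.param a ∈ R.inner) : a ∈ openSquare := by
  obtain ⟨b, hb, hab⟩ := h
  by_contra hna
  have hne : b ≠ a := fun h => hna (h ▸ hb)
  obtain ⟨U, V, hU, hV, hbU, haV, hUV⟩ := t2_separation hne
  have hopen := R.isOpen_image (U ∩ openSquare) inter_subset_right (hU.inter isOpen_openSquare)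
  have h1 : ∀ᶠ c in 𝓝[openSquare] a, R.param c ∈ R.param '' (U ∩ openSquare) :=
    ((R.continuousOn a ha).mono openSquare_subset).eventually_mem
      (hopen.mem_nhds ⟨b, ⟨hbU, hb⟩, hab⟩)
  have : (𝓝[openSquare] a).NeBot := by
    rw [← mem_closure_iff_nhdsWithin_neBot, closure_openSquare]
    exact ha
  obtain ⟨c, ⟨⟨u, hu, huc⟩, hcV⟩, hc⟩ :=
    ((h1.and (mem_nhdsWithin_of_mem_nhds (hV.mem_nhds haV))).and self_mem_nhdsWithin).exists
  rw [R.injOn hu.2 hc huc] at hu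
  exact disjoint_left.1 hUV hu.1 hcV

/-- The coordinates in the unit square of an interior point of a rectangle. -/
noncomputable def coord (x : S) : ℝ × ℝ := Function.invFunOn R.param openSquare x

lemma coord_mem {x : S} (hx : x ∈ R.inner) : R.coord x ∈ openSquare :=
  Function.invFunOn_mem hx

lemma param_coord {x : S} (hx : x ∈ R.inner) : R.param (R.coord x) = x :=
  Function.invFunOn_eq hx

lemma coord_param {a : ℝ × ℝ} (ha : a ∈ openSquare) : R.coord (R.param a) = a :=
  R.injOn (R.coord_mem ⟨a, ha, rfl⟩) ha (R.param_coord ⟨a, ha, rfl⟩)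

lemma continuousAt_coord {x : S} (hx : x ∈ R.inner) : ContinuousAt R.coord x := by
  intro V hV
  obtain ⟨U, hUV, hU, hxU⟩ := mem_nhds_iff.1 hV
  have hopen := R.isOpen_image (U ∩ openSquare) inter_subset_right (hU.inter isOpen_openSquare)
  refine mem_map.2 (mem_of_superset
    (hopen.mem_nhds ⟨R.coord x, ⟨hxU, R.coord_mem hx⟩, R.param_coord hx⟩) ?_)
  rintro _ ⟨a, ha, rfl⟩
  rw [mem_preimage, R.coord_param ha.2]
  exact hUV ha.1

/-- The same rectangle, with its horizontal and vertical directions exchanged. -/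
noncomputable def dual : Rectangle M.dual where
  param := R.param ∘ Prod.swap
  continuousOn := R.continuousOn.comp continuous_swap.continuousOn fun _ ha => ⟨ha.2, ha.1⟩
  injOn := R.injOn.comp Prod.swap_injective.injOn fun _ ha => ⟨ha.2, ha.1⟩
  isOpen_image U hU hUo := by
    rw [image_comp]
    refine R.isOpen_image _ ?_ ((Homeomorph.prodComm ℝ ℝ).isOpenMap U hUo)
    rintro _ ⟨a, ha, rfl⟩
    exact ⟨(hU ha).2, (hU ha).1⟩
  horizontal_injOn := R.vertical_injOn
  horizontal_stable t ht := M.isStablePath_dual.2 (R.vertical_unstable t ht)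
  vertical_injOn := R.horizontal_injOn
  vertical_unstable t ht := M.isUnstablePath_dual.2 (R.horizontal_stable t ht)
  orientation a ha := by
    have h1 : Tendsto Prod.swap (𝓝 a) (𝓝 a.swap) := continuous_swap.continuousAt
    filter_upwards [h1.eventually (R.orientation a.swap ⟨ha.2, ha.1⟩)] with b hb hpos
    have h2 := hb (by rw [mul_comm]; exact hpos)
    change 0 < (M.dual.form (R.param a.swap) (R.param b.swap)).im
    rw [M.form_dual, map_neg, Complex.neg_im, Complex.conj_im, neg_neg]
    exact h2

lemma carrier_dual : R.dual.carrier = R.carrier := by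
  change (R.param ∘ Prod.swap) '' _ = _
  rw [image_comp, image_swap_prod]
  rfl

lemma inner_dual : R.dual.inner = R.inner := by
  change (R.param ∘ Prod.swap) '' _ = _
  rw [image_comp, image_swap_prod]
  rfl

lemma coord_dual {x : S} (hx : x ∈ R.inner) : R.dual.coord x = (R.coord x).swap := by
  have h : R.dual.param (R.coord x).swap = x := by
    change R.param (R.coord x).swap.swap = x
    rw [Prod.swap_swap, R.param_coord hx]
  have h' := R.coord_mem hx
  rw [← R.dual.coord_param (a := (R.coord x).swap) ⟨h'.2, h'.1⟩, h]

/-- `H` parametrizes the horizontal leaves of `R` by transverse length: its increments between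
nearby interior leaves are those of the transverse coordinate of the stable foliation. -/
def IsHeightFunction (H : ℝ → ℝ) : Prop :=
  StrictMonoOn H (Icc 0 1) ∧ ContinuousOn H (Icc 0 1) ∧
    ∀ a ∈ openSquare, ∀ᶠ b in 𝓝 a, M.height (R.param a) (R.param b) = |H b.2 - H a.2|

/-- Near an interior point of a rectangle, the transverse coordinate depends on the vertical
coordinate only. -/
lemma eventually_height_param_eq {a : ℝ × ℝ} (ha : a ∈ openSquare) :
    ∀ᶠ b in 𝓝 a,
      M.height (R.param a) (R.param b) = M.height (R.param a) (R.param (a.1, b.2)) := by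
  have h1 : R.param ⁻¹' (M.chart (R.param a)).source ∩ openSquare ∈ 𝓝 a :=
    inter_mem (R.continuousAt_param ha (M.source_mem_nhds _)) (isOpen_openSquare.mem_nhds ha)
  obtain ⟨ε, hε, hball⟩ := Metric.mem_nhds_iff.1 h1
  filter_upwards [Metric.ball_mem_nhds a hε] with b hb
  rw [← ball_prod_same] at hball hb
  have hb2 : b.2 ∈ Icc (0 : ℝ) 1 := (openSquare_subset (hball hb).2).2
  refine (R.horizontal_stable b.2 hb2).height_eq (p := R.param a)
    (J := Metric.ball a.1 ε) (convex_ball _ _).isPreconnected ?_ ?_ hb.1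
    (Metric.mem_ball_self hε)
  · intro s hs
    exact (openSquare_subset (@hball (s, b.2) ⟨hs, hb.2⟩).2).1
  · intro s hs
    exact (@hball (s, b.2) ⟨hs, hb.2⟩).1

/-- The length of vertical arcs of a rectangle is invariant under sliding along the horizontal
leaves. Hence a length function for the middle vertical leaf serves for all of them. -/
theorem exists_isHeightFunction : ∃ H, R.IsHeightFunction H := by
  have hhalf : (1 / 2 : ℝ) ∈ Ioo (0 : ℝ) 1 := by constructor <;> norm_num
  have hhalf' := Ioo_subset_Icc_self hhalf
  obtain ⟨H, hH⟩ := (R.vertical_unstable _ hhalf').exists_isLength (R.vertical_injOn _ hhalf')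
  refine ⟨H, hH.1, hH.continuousOn (R.vertical_unstable _ hhalf').1, ?_⟩
  let Good : ℝ → ℝ → Prop := fun s t₀ =>
    ∀ᶠ t in 𝓝 t₀, |H t - H t₀| = M.height (R.param (s, t₀)) (R.param (s, t))
  have hgood : ∀ t₀ ∈ Ioo (0 : ℝ) 1, ∀ s ∈ Ioo (0 : ℝ) 1, Good s t₀ := by
    intro t₀ ht₀ s hs
    have hstart : Good (1 / 2) t₀ := by
      have := hH.2 t₀ (Ioo_subset_Icc_self ht₀)
      rwa [nhdsWithin_eq_nhds.2 (Icc_mem_nhds ht₀.1 ht₀.2)] at this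
    refine (isPreconnected_Ioo.induction₂ (s := Ioo (0 : ℝ) 1)
      (fun s s' => Good s t₀ ↔ Good s' t₀) ?_ (fun _ _ _ _ _ _ h h' => h.trans h')
      (fun _ _ _ _ h => h.symm) hhalf hs).1 hstart
    intro s₀ hs₀
    have ha : (s₀, t₀) ∈ openSquare := ⟨hs₀, ht₀⟩
    have hsource : ∀ᶠ b in 𝓝 (s₀, t₀), R.param b ∈ (M.chart (R.param (s₀, t₀))).source :=
      R.continuousAt_param ha (M.source_mem_nhds _)
    have hev := ((R.eventually_height_param_eq ha).and hsource).eventually_nhds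
    have hline : Tendsto (fun s => (s, t₀)) (𝓝 s₀) (𝓝 (s₀, t₀)) :=
      (Continuous.prodMk_left t₀).continuousAt
    refine mem_nhdsWithin_of_mem_nhds ?_
    filter_upwards [hline.eventually hev, isOpen_Ioo.mem_nhds hs₀] with s hs hs01
    have hq : M.height (R.param (s₀, t₀)) (R.param (s, t₀)) = 0 := by
      rw [hs.self_of_nhds.1, M.height_self]
    have hline' : Tendsto (fun t => (s, t)) (𝓝 t₀) (𝓝 (s, t₀)) :=
      (Continuous.prodMk_right s).continuousAt
    have hcomp := (R.continuousAt_param (a := (s, t₀)) ⟨hs01, ht₀⟩).eventually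
      (M.height_compat hs.self_of_nhds.2)
    refine eventually_congr ?_
    filter_upwards [hline'.eventually hs, hline'.eventually hcomp] with t h1 h2
    rw [hq, sub_zero, abs_of_nonneg (M.height_nonneg _ _), h1.1] at h2
    rw [h2]
  intro a ha
  have h2 : Tendsto Prod.snd (𝓝 a) (𝓝 a.2) := continuous_snd.continuousAt
  filter_upwards [R.eventually_height_param_eq ha, h2.eventually (hgood a.2 ha.2 a.1 ha.1)]
    with b h1 h2
  rw [h1, h2]

/-- The height of an interior point of a rectangle, with respect to a height function. -/
lemma IsHeightFunction.eventually_height_eq {R : Rectangle M} {H : ℝ → ℝ}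
    (hH : R.IsHeightFunction H) {x : S} (hx : x ∈ R.inner) :
    ∀ᶠ y in 𝓝 x, M.height x y = |H (R.coord y).2 - H (R.coord x).2| := by
  have h := (R.continuousAt_coord hx).eventually (hH.2.2 _ (R.coord_mem hx))
  filter_upwards [h, R.isOpen_inner.mem_nhds hx] with y hy hy'
  rwa [R.param_coord hx, R.param_coord hy'] at hy

end Rectangle

/-! ### Sub-rectangles cross their rectangle completely -/

/-- If two injective paths in a Hausdorff space have the same image, then interior parameters of
one correspond to interior parameters of the other. -/
lemma mem_image_Ioo_of_image_Icc_eq [T2Space S] {γ δ : ℝ → S} (hγ : ContinuousOn γ (Icc 0 1))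
    (hδ : ContinuousOn δ (Icc 0 1)) (hγi : InjOn γ (Icc 0 1)) (hδi : InjOn δ (Icc 0 1))
    (h : γ '' Icc 0 1 = δ '' Icc 0 1) {s : ℝ} (hs : s ∈ Ioo (0 : ℝ) 1) :
    γ s ∈ δ '' Ioo 0 1 := by
  -- The change of parameter is a homeomorphism of `[0,1]`, hence strictly monotone.
  let φ : ℝ → ℝ := fun s => Function.invFunOn δ (Icc 0 1) (γ s)
  have hmem : ∀ s ∈ Icc (0 : ℝ) 1, γ s ∈ δ '' Icc 0 1 := fun s hs => h ▸ ⟨s, hs, rfl⟩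
  have hφm : ∀ s ∈ Icc (0 : ℝ) 1, φ s ∈ Icc (0 : ℝ) 1 := fun s hs =>
    Function.invFunOn_mem (hmem s hs)
  have hφ : ∀ s ∈ Icc (0 : ℝ) 1, δ (φ s) = γ s := fun s hs => Function.invFunOn_eq (hmem s hs)
  have hφi : InjOn φ (Icc 0 1) := fun s hs t ht hst => hγi hs ht (by
    rw [← hφ s hs, ← hφ t ht, hst])
  have hφc : ContinuousOn φ (Icc 0 1) := by
    rw [continuousOn_iff_isClosed]
    intro C hC
    have hK : IsCompact (δ '' (C ∩ Icc 0 1)) :=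
      (isCompact_Icc.inter_left hC).image_of_continuousOn (hδ.mono inter_subset_right)
    obtain ⟨D, hD, hDe⟩ := continuousOn_iff_isClosed.1 hγ _ hK.isClosed
    refine ⟨D, hD, ?_⟩
    rw [← hDe]
    ext s
    constructor
    · rintro ⟨h1, h2⟩
      exact ⟨⟨φ s, ⟨h1, hφm s h2⟩, hφ s h2⟩, h2⟩
    · rintro ⟨⟨u, ⟨hu, hu'⟩, h1⟩, h2⟩
      refine ⟨?_, h2⟩
      rw [← hφ s h2] at h1
      rwa [mem_preimage, ← hδi hu' (hφm s h2) h1]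
  have hs' := Ioo_subset_Icc_self hs
  have h0 : (0 : ℝ) ∈ Icc (0 : ℝ) 1 := left_mem_Icc.2 zero_le_one
  have h1 : (1 : ℝ) ∈ Icc (0 : ℝ) 1 := right_mem_Icc.2 zero_le_one
  refine ⟨φ s, ?_, hφ s hs'⟩
  rcases hφc.strictMonoOn_of_injOn_Icc' zero_le_one hφi with hm | hm
  · exact ⟨(hφm 0 h0).1.trans_lt (hm h0 hs' hs.1), (hm hs' h1 hs.2).trans_le (hφm 1 h1).2⟩
  · exact ⟨(hφm 1 h1).1.trans_lt (hm hs' h1 hs.2), (hm h0 hs' hs.1).trans_le (hφm 0 h0).2⟩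

namespace Rectangle

variable {M : TransverseFoliations S} (R : Rectangle M)

/-- With each of its points, assumed to lie in the interior of the rectangle `R`, the set `D`
contains the whole open horizontal leaf of `R` through that point. -/
def IsHorizontallySaturated (D : Set S) : Prop :=
  ∀ x ∈ D, ∀ s ∈ Ioo (0 : ℝ) 1, R.param (s, (R.coord x).2) ∈ D

/-- The open leaves of a horizontal sub-rectangle are open leaves of the rectangle, although the
definition only compares closed leaves. -/
lemma IsHorizontalSubrectangle.isHorizontallySaturated [T2Space S] {R H : Rectangle M}
    (h : H.IsHorizontalSubrectangle R) (hHR : H.inner ⊆ R.inner) :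
    R.IsHorizontallySaturated H.inner := by
  rintro _ ⟨⟨s₀, t⟩, ⟨hs₀, ht⟩, rfl⟩ s hs
  have hx : H.param (s₀, t) ∈ R.inner := hHR ⟨_, ⟨hs₀, ht⟩, rfl⟩
  obtain ⟨t', ht', hleaf⟩ := h.2 t ht
  have ht01 := Ioo_subset_Icc_self ht
  have hmem : H.param (s₀, t) ∈ R.horizontalLeaf t' :=
    hleaf ▸ ⟨s₀, Ioo_subset_Icc_self hs₀, rfl⟩
  obtain ⟨s₁, hs₁, he⟩ := hmem
  have hin : (s₁, t') ∈ openSquare :=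
    R.mem_openSquare_of_param_mem_inner ⟨hs₁, ht'⟩ (by
      rw [show R.param (s₁, t') = _ from he]
      exact hx)
  have hc : R.coord (H.param (s₀, t)) = (s₁, t') := by
    rw [← show R.param (s₁, t') = _ from he, R.coord_param hin]
  obtain ⟨u, hu, hu'⟩ := mem_image_Ioo_of_image_Icc_eq (R.horizontal_stable t' ht').1
    (H.horizontal_stable t ht01).1 (R.horizontal_injOn t' ht') (H.horizontal_injOn t ht01)
    hleaf.symm hs
  rw [hc]
  exact ⟨(u, t), ⟨hu, ht⟩, hu'⟩

end Rectangle

namespace MarkovPartition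

variable {M : TransverseFoliations S} {f : S ≃ₜ S} {n : ℕ} (R : MarkovPartition M f n)

/-- The Markov partition of `f⁻¹` with the horizontal and the vertical direction exchanged. -/
noncomputable def dual : MarkovPartition M.dual f.symm n where
  rect i := (R.rect i).dual
  cover := by simpa only [Rectangle.carrier_dual] using R.cover
  disjoint i j hij := by simpa only [Rectangle.inner_dual] using R.disjoint i j hij
  horizontal i j x hx := by
    simp only [Rectangle.inner_dual, ← f.image_eq_preimage_symm] at hx ⊢
    rw [inter_comm] at hx ⊢
    obtain ⟨V, hV, hc, hl⟩ := R.vertical j i x hx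
    exact ⟨V.dual, V.inner_dual.trans hV,
      by rw [Rectangle.carrier_dual, Rectangle.carrier_dual]; exact hc, hl⟩
  vertical i j x hx := by
    simp only [Rectangle.inner_dual, f.symm.image_eq_preimage_symm, Homeomorph.symm_symm] at hx ⊢
    rw [inter_comm] at hx ⊢
    obtain ⟨H, hH, hc, hl⟩ := R.horizontal j i x hx
    exact ⟨H.dual, H.inner_dual.trans hH,
      by rw [Rectangle.carrier_dual, Rectangle.carrier_dual]; exact hc, hl⟩

/-- The points in the interior of `R_i` which `f` maps into the interior of `R_j`. -/
def crossing (i j : Fin n) : Set S := (R.rect i).inner ∩ f ⁻¹' (R.rect j).inner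

lemma crossing_dual (i j : Fin n) : R.dual.crossing j i = f '' R.crossing i j := by
  rw [crossing, crossing, image_inter f.injective, f.image_preimage, inter_comm,
    f.image_eq_preimage_symm]
  exact congrArg₂ _ (congrArg _ (R.rect i).inner_dual) (R.rect j).inner_dual

lemma crossing_isHorizontallySaturated [T2Space S] (i j : Fin n) :
    (R.rect i).IsHorizontallySaturated (R.crossing i j) := by
  intro x hx s hs
  obtain ⟨H, hH, hsub⟩ := R.horizontal i j x hx
  have h1 : H.inner ⊆ R.crossing i j := hH ▸ connectedComponentIn_subset _ _
  have hxH : x ∈ H.inner := hH ▸ mem_connectedComponentIn hx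
  exact h1 (hsub.isHorizontallySaturated (h1.trans inter_subset_left) x hxH s hs)

/-! ### The incidence matrix -/

/-- Overlapping interiors belong to the same rectangle. -/
lemma eq_of_mem_inner {i j : Fin n} {x : S} (hi : x ∈ (R.rect i).inner)
    (hj : x ∈ (R.rect j).inner) : i = j := by
  by_contra h
  exact disjoint_left.1 (R.disjoint i j h) hi hj

lemma eq_of_mem_inner_of_mem_carrier {i j : Fin n} {x : S} (hi : x ∈ (R.rect i).inner)
    (hj : x ∈ (R.rect j).carrier) : i = j := by
  obtain ⟨y, hyi, hyj⟩ := mem_closure_iff.1 ((R.rect j).carrier_subset_closure_inner hj) _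
    (R.rect i).isOpen_inner hi
  exact R.eq_of_mem_inner hyi hyj

/-- The component of a crossing is open, being the interior of a sub-rectangle. -/
lemma isOpen_component_crossing {i j : Fin n} {x : S} (hx : x ∈ R.crossing i j) :
    IsOpen (connectedComponentIn (R.crossing i j) x) := by
  obtain ⟨H, hH, -⟩ := R.horizontal i j x hx
  exact hH ▸ H.isOpen_inner

lemma image_component_crossing {i j : Fin n} {x : S} (hx : x ∈ R.crossing i j) :
    f '' connectedComponentIn (R.crossing i j) x
      = connectedComponentIn (f '' (R.rect i).inner ∩ (R.rect j).inner) (f x) := by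
  rw [f.image_connectedComponentIn hx, crossing, image_inter f.injective, f.image_preimage]

lemma closure_component_mem {i j : Fin n} {x : S} (hx : x ∈ R.crossing i j) :
    closure (connectedComponentIn (R.crossing i j) x) ∈
      {H | H ∈ R.horizontalSubrectangles i ∧ f '' H ∈ R.verticalSubrectangles j} := by
  refine ⟨⟨j, x, hx, rfl⟩, i, f x, ⟨⟨x, hx.1, rfl⟩, hx.2⟩, ?_⟩
  rw [f.image_closure, R.image_component_crossing hx]

/-- The incidence coefficient is nonzero exactly when the crossing is nonempty. -/
lemma incidenceMatrix_ne_zero_iff (i j : Fin n) :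
    R.incidenceMatrix i j ≠ 0 ↔ (R.crossing i j).Nonempty := by
  rw [incidenceMatrix, encard_ne_zero]
  constructor
  · rintro ⟨_, ⟨j', x, hx, rfl⟩, i', y, hy, he⟩
    change f '' closure (connectedComponentIn (R.crossing i j') x) = _ at he
    rw [f.image_closure, R.image_component_crossing hx] at he
    have hx' : f x ∈
        closure (connectedComponentIn (f '' (R.rect i').inner ∩ (R.rect j).inner) y) :=
      he ▸ subset_closure (mem_connectedComponentIn ⟨⟨x, hx.1, rfl⟩, hx.2⟩)
    have hopen :
        IsOpen (connectedComponentIn (f '' (R.rect i).inner ∩ (R.rect j').inner) (f x)) := by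
      rw [← R.image_component_crossing hx]
      exact f.isOpenMap _ (R.isOpen_component_crossing hx)
    obtain ⟨z, hz, hz'⟩ := mem_closure_iff.1 hx' _ hopen
      (mem_connectedComponentIn ⟨⟨x, hx.1, rfl⟩, hx.2⟩)
    obtain ⟨⟨u, hu, rfl⟩, -⟩ := connectedComponentIn_subset _ _ hz
    exact ⟨u, hu, (connectedComponentIn_subset _ _ hz').2⟩
  · rintro ⟨x, hx⟩
    exact ⟨_, R.closure_component_mem hx⟩

/-- For a binary incidence matrix, every crossing is connected: two components would give two
horizontal sub-rectangles. -/
lemma isPreconnected_crossing (hA : IsBinary R.incidenceMatrix) (i j : Fin n) :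
    IsPreconnected (R.crossing i j) := by
  rcases (R.crossing i j).eq_empty_or_nonempty with h | ⟨x, hx⟩
  · rw [h]
    exact isPreconnected_empty
  have hle : R.incidenceMatrix i j ≤ 1 := by
    rcases hA i j with h | h <;> simp [h]
  rw [incidenceMatrix, encard_le_one_iff] at hle
  have hsub : R.crossing i j ⊆ connectedComponentIn (R.crossing i j) x := by
    intro y hy
    have he := hle _ _ (R.closure_component_mem hx) (R.closure_component_mem hy)
    have hy' : y ∈ closure (connectedComponentIn (R.crossing i j) x) :=
      he ▸ subset_closure (mem_connectedComponentIn hy)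
    obtain ⟨z, hz, hz'⟩ := mem_closure_iff.1 hy' _ (R.isOpen_component_crossing hy)
      (mem_connectedComponentIn hy)
    rw [connectedComponentIn_eq hz', ← connectedComponentIn_eq hz]
    exact mem_connectedComponentIn hy
  rw [hsub.antisymm (connectedComponentIn_subset _ _)]
  exact isPreconnected_connectedComponentIn

end MarkovPartition

/-! ### Expansion of heights -/

/-- On the unstable foliation, `f` acts by the inverse of the scaling constant of `f⁻¹`. -/
lemma IsPseudoAnosov.exists_scalesHeight_dual {M : TransverseFoliations S} {f : S ≃ₜ S}
    (hf : IsPseudoAnosov M f) : ∃ c, ScalesHeight M.dual f c := by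
  obtain ⟨lam, hlam, h⟩ := hf.dual.exists_height_map
  refine ⟨lam⁻¹, fun p => ?_⟩
  have h1 := f.continuous.continuousAt.eventually (h (f p))
  filter_upwards [h1] with x hx
  rw [f.symm_apply_apply, f.symm_apply_apply] at hx
  rw [hx, ← mul_assoc, inv_mul_cancel₀ (by positivity), one_mul]

namespace Rectangle

variable {M : TransverseFoliations S} {R R' : Rectangle M} {f : S ≃ₜ S} {c : ℝ} {H H' : ℝ → ℝ}

lemma eventually_abs_height_map (hc : ScalesHeight M f c) (hH : R.IsHeightFunction H)
    (hH' : R'.IsHeightFunction H') {x : S} (hx : x ∈ R.inner ∩ f ⁻¹' R'.inner) :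
    ∀ᶠ y in 𝓝 x, |H' (R'.coord (f y)).2 - H' (R'.coord (f x)).2|
      = c * |H (R.coord y).2 - H (R.coord x).2| := by
  filter_upwards [hc x, hH.eventually_height_eq hx.1,
    f.continuous.continuousAt.eventually (hH'.eventually_height_eq hx.2)] with y h1 h2 h3
  rw [← h2, ← h3, h1]

/-- Horizontal arcs are mapped into horizontal leaves. -/
lemma coord_map_snd_eq (hc : ScalesHeight M f c) {a b t : ℝ} (ht : t ∈ Ioo (0 : ℝ) 1)
    (hab : uIcc a b ⊆ Ioo 0 1) (hm : ∀ s ∈ uIcc a b, f (R.param (s, t)) ∈ R'.inner) :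
    (R'.coord (f (R.param (a, t)))).2 = (R'.coord (f (R.param (b, t)))).2 := by
  obtain ⟨H, hH⟩ := R.exists_isHeightFunction
  obtain ⟨H', hH'⟩ := R'.exists_isHeightFunction
  refine isPreconnected_uIcc.induction₂ (s := uIcc a b)
    (fun s s' => (R'.coord (f (R.param (s, t)))).2 = (R'.coord (f (R.param (s', t)))).2) ?_
    (fun _ _ _ _ _ _ h h' => h.trans h') (fun _ _ _ _ h => h.symm) left_mem_uIcc right_mem_uIcc
  intro s hs
  have hsq : (s, t) ∈ openSquare := ⟨hab hs, ht⟩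
  have hline : Tendsto (fun s' => (s', t)) (𝓝[uIcc a b] s) (𝓝 (s, t)) :=
    (Continuous.prodMk_left t).continuousAt.mono_left nhdsWithin_le_nhds
  have hev := (R.continuousAt_param hsq).eventually
    (eventually_abs_height_map hc hH hH' ⟨⟨_, hsq, rfl⟩, hm s hs⟩)
  filter_upwards [hline.eventually hev, self_mem_nhdsWithin] with s' h1 h2
  have hsq' : (s', t) ∈ openSquare := ⟨hab h2, ht⟩
  rw [R.coord_param hsq, R.coord_param hsq', sub_self, abs_zero, mul_zero, abs_eq_zero,
    sub_eq_zero] at h1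
  exact (hH'.1.injOn (Ioo_subset_Icc_self (R'.coord_mem (hm s' h2)).2)
    (Ioo_subset_Icc_self (R'.coord_mem (hm s hs)).2) h1).symm

/-- Vertical arcs are mapped into vertical leaves. -/
lemma coord_map_fst_eq (hc : ScalesHeight M.dual f c) {a b s : ℝ} (hs : s ∈ Ioo (0 : ℝ) 1)
    (hab : uIcc a b ⊆ Ioo 0 1) (hm : ∀ t ∈ uIcc a b, f (R.param (s, t)) ∈ R'.inner) :
    (R'.coord (f (R.param (s, a)))).1 = (R'.coord (f (R.param (s, b)))).1 := by
  have h := coord_map_snd_eq (R := R.dual) (R' := R'.dual) hc hs hab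
    fun t ht => R'.inner_dual.symm ▸ hm t ht
  have e : ∀ t, R.dual.param (t, s) = R.param (s, t) := fun t => rfl
  rw [e, e, R'.coord_dual (hm a left_mem_uIcc), R'.coord_dual (hm b right_mem_uIcc)] at h
  exact h

/-- On a connected union of full horizontal leaves that is mapped into the interior of a rectangle,
differences of heights are multiplied by `c`. -/
theorem abs_height_map (hc0 : 0 < c) (hc : ScalesHeight M f c) {c' : ℝ}
    (hc' : ScalesHeight M.dual f c') (hH : R.IsHeightFunction H) (hH' : R'.IsHeightFunction H')
    (hpre : IsPreconnected (R.inner ∩ f ⁻¹' R'.inner))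
    (hsat : R.IsHorizontallySaturated (R.inner ∩ f ⁻¹' R'.inner)) {x y : S}
    (hx : x ∈ R.inner ∩ f ⁻¹' R'.inner) (hy : y ∈ R.inner ∩ f ⁻¹' R'.inner) :
    |H' (R'.coord (f x)).2 - H' (R'.coord (f y)).2|
      = c * |H (R.coord x).2 - H (R.coord y).2| := by
  set D := R.inner ∩ f ⁻¹' R'.inner with hD
  -- The heights of the points of `D` fill an interval.
  have hJ : (((fun x => (R.coord x).2) '' D)).OrdConnected :=
    (hpre.image _ fun z hz => ((continuous_snd.continuousAt.comp
      (R.continuousAt_coord hz.1))).continuousWithinAt).ordConnected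
  have hmemD : ∀ t ∈ uIcc (R.coord x).2 (R.coord y).2, ∀ s ∈ Ioo (0 : ℝ) 1,
      t ∈ Ioo (0 : ℝ) 1 ∧ R.param (s, t) ∈ D := by
    intro t ht s hs
    obtain ⟨z, hz, rfl⟩ := hJ.uIcc_subset ⟨x, hx, rfl⟩ ⟨y, hy, rfl⟩ ht
    exact ⟨(R.coord_mem hz.1).2, hsat z hz s hs⟩
  set s₀ := (R.coord x).1 with hs₀d
  set t₁ := (R.coord x).2 with ht₁
  set t₂ := (R.coord y).2 with ht₂
  have hs₀ : s₀ ∈ Ioo (0 : ℝ) 1 := (R.coord_mem hx.1).1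
  have hI : uIcc t₁ t₂ ⊆ Ioo 0 1 := fun t ht => (hmemD t ht s₀ hs₀).1
  set K : ℝ → ℝ := fun t => H' (R'.coord (f (R.param (s₀, t)))).2 with hK
  have hKx : H' (R'.coord (f x)).2 = K t₁ := by
    rw [hK]
    simp only
    rw [hs₀d, ht₁, Prod.mk.eta, R.param_coord hx.1]
  -- Slide `y` horizontally to the vertical leaf of `x`.
  have hKy : H' (R'.coord (f y)).2 = K t₂ := by
    have h := coord_map_snd_eq (R := R) (R' := R') hc (a := (R.coord y).1) (b := s₀)
      (hI right_mem_uIcc) (ordConnected_Ioo.uIcc_subset (R.coord_mem hy.1).1 hs₀)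
      fun s hs => (hmemD t₂ right_mem_uIcc s
        (ordConnected_Ioo.uIcc_subset (R.coord_mem hy.1).1 hs₀ hs)).2.2
    rw [ht₂, Prod.mk.eta, R.param_coord hy.1] at h
    rw [h]
  have hloc : ∀ t ∈ uIcc t₁ t₂, ∀ᶠ t' in 𝓝[uIcc t₁ t₂] t, |K t' - K t| = c * |H t' - H t| := by
    intro t ht
    have hsq : (s₀, t) ∈ openSquare := ⟨hs₀, hI ht⟩
    have hline : Tendsto (fun t' => (s₀, t')) (𝓝[uIcc t₁ t₂] t) (𝓝 (s₀, t)) :=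
      (Continuous.prodMk_right s₀).continuousAt.mono_left nhdsWithin_le_nhds
    have hev := (R.continuousAt_param hsq).eventually
      (eventually_abs_height_map hc hH hH' (hmemD t ht s₀ hs₀).2)
    filter_upwards [hline.eventually hev, self_mem_nhdsWithin] with t' h1 h2
    have hsq' : (s₀, t') ∈ openSquare := ⟨hs₀, hI h2⟩
    rwa [R.coord_param hsq, R.coord_param hsq'] at h1
  have hHc : ContinuousOn H (uIcc t₁ t₂) := hH.2.1.mono (hI.trans Ioo_subset_Icc_self)
  have hKc : ContinuousOn K (uIcc t₁ t₂) := by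
    intro t ht
    rw [ContinuousWithinAt, tendsto_iff_dist_tendsto_zero]
    have h1 : Tendsto (fun t' => c * |H t' - H t|) (𝓝[uIcc t₁ t₂] t) (𝓝 0) := by
      have := (((hHc t ht).tendsto.sub_const (H t)).abs).const_mul c
      simpa using this
    exact h1.congr' ((hloc t ht).mono fun t' ht' => by simp only [Real.dist_eq, ht'])
  have hKi : InjOn K (uIcc t₁ t₂) := by
    intro t ht t' ht' he
    have hsub : uIcc t t' ⊆ uIcc t₁ t₂ := uIcc_subset_uIcc ht ht'
    have hin := (hmemD t ht s₀ hs₀).2.2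
    have hin' := (hmemD t' ht' s₀ hs₀).2.2
    have h1 := coord_map_fst_eq (R := R) (R' := R') hc' hs₀ (hsub.trans hI)
      fun u hu => (hmemD u (hsub hu) s₀ hs₀).2.2
    have h2 := hH'.1.injOn (Ioo_subset_Icc_self (R'.coord_mem hin).2)
      (Ioo_subset_Icc_self (R'.coord_mem hin').2) he
    have h3 : f (R.param (s₀, t)) = f (R.param (s₀, t')) := by
      rw [← R'.param_coord hin, ← R'.param_coord hin', Prod.ext h1 h2]
    have h4 : ((s₀, t) : ℝ × ℝ) = (s₀, t') :=
      @R.injOn (s₀, t) ⟨hs₀, hI ht⟩ (s₀, t') ⟨hs₀, hI ht'⟩ (f.injective h3)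
    exact congrArg Prod.snd h4
  -- As `K` and `H` are monotone, the signs in the local identity agree everywhere.
  have hfin : ∀ ε : ℝ, |ε| = 1 →
      (∀ t ∈ uIcc t₁ t₂, ∀ᶠ t' in 𝓝[uIcc t₁ t₂] t, K t' - K t = ε * (c * (H t' - H t))) →
      |K t₁ - K t₂| = c * |H t₁ - H t₂| := by
    intro ε hε h
    have h1 := isPreconnected_uIcc.induction₂ (s := uIcc t₁ t₂)
      (fun t t' => K t' - K t = ε * (c * (H t' - H t))) h
      (fun _ _ _ _ _ _ h h' => by linear_combination h + h')
      (fun _ _ _ _ h => by linear_combination -h) right_mem_uIcc left_mem_uIcc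
    rw [h1, abs_mul, hε, one_mul, abs_mul, abs_of_pos hc0]
  rw [hKx, hKy]
  have hmono : StrictMonoOn H (uIcc t₁ t₂) := hH.1.mono (hI.trans Ioo_subset_Icc_self)
  have hKm : StrictMonoOn K (uIcc t₁ t₂) ∨ StrictAntiOn K (uIcc t₁ t₂) :=
    hKc.strictMonoOn_of_injOn_Icc' inf_le_sup hKi
  rcases hKm with hm | hm
  · refine hfin 1 abs_one fun t ht => ?_
    filter_upwards [hloc t ht, self_mem_nhdsWithin] with t' h ht'
    rcases le_total t t' with hle | hle
    · have h1 := hm.monotoneOn ht ht' hle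
      have h2 := hmono.monotoneOn ht ht' hle
      rw [abs_of_nonneg (by linarith), abs_of_nonneg (by linarith)] at h
      linarith
    · have h1 := hm.monotoneOn ht' ht hle
      have h2 := hmono.monotoneOn ht' ht hle
      rw [abs_of_nonpos (by linarith), abs_of_nonpos (by linarith)] at h
      linarith
  · refine hfin (-1) (by simp) fun t ht => ?_
    filter_upwards [hloc t ht, self_mem_nhdsWithin] with t' h ht'
    rcases le_total t t' with hle | hle
    · have h1 := hm.antitoneOn ht ht' hle
      have h2 := hmono.monotoneOn ht ht' hle
      rw [abs_of_nonpos (by linarith), abs_of_nonneg (by linarith)] at h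
      linarith
    · have h1 := hm.antitoneOn ht' ht hle
      have h2 := hmono.monotoneOn ht' ht hle
      rw [abs_of_nonneg (by linarith), abs_of_nonpos (by linarith)] at h
      linarith

end Rectangle

/-! ### Cylinders -/

namespace MarkovPartition

variable {M : TransverseFoliations S} {f : S ≃ₜ S} {n : ℕ} (R : MarkovPartition M f n)

/-- The points whose first `b + 1` iterates `x, f x, …, f^b x` visit the interiors of the
rectangles with indices `u 0, u 1, …, u b`. -/
def cylinder : ℕ → (ℕ → Fin n) → Set S
  | 0, u => (R.rect (u 0)).inner
  | b + 1, u => (R.rect (u 0)).inner ∩ f ⁻¹' cylinder b (fun z => u (z + 1))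

lemma mem_cylinder_iff {b : ℕ} {u : ℕ → Fin n} {x : S} :
    x ∈ R.cylinder b u ↔ ∀ z ≤ b, (f ^ z : S ≃ₜ S) x ∈ (R.rect (u z)).inner := by
  induction b generalizing u x with
  | zero => simp [cylinder]
  | succ b ih =>
    simp only [cylinder, mem_inter_iff, mem_preimage, ih]
    constructor
    · rintro ⟨h0, h⟩ (_ | z) hz
      · exact h0
      · exact h z (by omega)
    · intro h
      exact ⟨h 0 (by omega), fun z hz => h (z + 1) (by omega)⟩

lemma cylinder_subset_inner (b : ℕ) (u : ℕ → Fin n) : R.cylinder b u ⊆ (R.rect (u 0)).inner :=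
  fun _ hx => R.mem_cylinder_iff.1 hx 0 b.zero_le

lemma cylinder_succ_subset_crossing (b : ℕ) (u : ℕ → Fin n) :
    R.cylinder (b + 1) u ⊆ R.crossing (u 0) (u 1) :=
  fun _ hx => ⟨hx.1, R.cylinder_subset_inner b _ hx.2⟩

/-- Every cylinder of an admissible word is a nonempty union of full horizontal leaves: the image
of a crossing consists of full vertical leaves, so it meets the next cylinder. -/
theorem cylinder_nonempty_and_saturated [T2Space S] (hf : IsPseudoAnosov M f) (b : ℕ)
    (u : ℕ → Fin n) (hu : ∀ z, (R.crossing (u z) (u (z + 1))).Nonempty) :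
    (R.cylinder b u).Nonempty ∧ (R.rect (u 0)).IsHorizontallySaturated (R.cylinder b u) := by
  obtain ⟨lam, -, hlam⟩ := hf.exists_height_map
  induction b generalizing u with
  | zero =>
    obtain ⟨x, hx⟩ := hu 0
    exact ⟨⟨x, hx.1⟩, fun y hy s hs => ⟨(s, _), ⟨hs, ((R.rect _).coord_mem hy).2⟩, rfl⟩⟩
  | succ b ih =>
    obtain ⟨⟨y, hy⟩, hsat⟩ := ih (fun z => u (z + 1)) fun z => hu (z + 1)
    have hy1 := R.cylinder_subset_inner b _ hy
    constructor
    · obtain ⟨x, hx⟩ := hu 0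
      have hfx : f x ∈ R.dual.crossing (u 1) (u 0) := by
        rw [R.crossing_dual]
        exact ⟨x, hx, rfl⟩
      have h1 := R.dual.crossing_isHorizontallySaturated _ _ _ hfx _
        ((R.rect (u 1)).coord_mem hy1).2
      rw [show (R.dual.rect (u 1)).coord (f x) = _ from (R.rect (u 1)).coord_dual hx.2,
        R.crossing_dual] at h1
      obtain ⟨z, hz, hz'⟩ := h1
      refine ⟨z, hz.1, ?_⟩
      have h2 := hsat y hy _ ((R.rect (u 1)).coord_mem hx.2).1
      rw [mem_preimage, hz']
      exact h2
    · intro x hx s hs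
      have hxD := R.cylinder_succ_subset_crossing b u hx
      have hD := R.crossing_isHorizontallySaturated (u 0) (u 1) x hxD
      have hc := (R.rect (u 0)).coord_mem hxD.1
      have hsub := ordConnected_Ioo.uIcc_subset hs hc.1
      have h1 := Rectangle.coord_map_snd_eq (R := R.rect (u 0)) (R' := R.rect (u 1)) hlam hc.2
        hsub fun s' hs' => (hD s' (hsub hs')).2
      rw [Prod.mk.eta, (R.rect (u 0)).param_coord hxD.1] at h1
      refine ⟨(hD s hs).1, ?_⟩
      have h2 := hsat (f x) hx.2 _ ((R.rect (u 1)).coord_mem (hD s hs).2).1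
      rw [← h1, Prod.mk.eta, Rectangle.param_coord _ (hD s hs).2] at h2
      exact h2

/-- The heights of cylinders shrink exponentially. -/
theorem exists_height_bound [T2Space S] (hf : IsPseudoAnosov M f)
    (hpre : ∀ i j, IsPreconnected (R.crossing i j)) :
    ∃ H : Fin n → ℝ → ℝ, (∀ i, (R.rect i).IsHeightFunction (H i)) ∧ ∃ r : ℕ → ℝ,
      Tendsto r atTop (𝓝 0) ∧ ∀ b u, ∀ x ∈ R.cylinder b u, ∀ y ∈ R.cylinder b u,
        |H (u 0) ((R.rect (u 0)).coord x).2 - H (u 0) ((R.rect (u 0)).coord y).2| ≤ r b := by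
  obtain ⟨lam, hlam1, hlam⟩ := hf.exists_height_map
  obtain ⟨c', hc'⟩ := hf.exists_scalesHeight_dual
  choose H hH using fun i => (R.rect i).exists_isHeightFunction
  have hlam0 : 0 < lam := by linarith
  have h01 : ∀ i, H i 0 ≤ H i 1 := fun i =>
    (hH i).1.monotoneOn (left_mem_Icc.2 zero_le_one) (right_mem_Icc.2 zero_le_one) zero_le_one
  refine ⟨H, hH, fun b => (∑ i, (H i 1 - H i 0)) * lam⁻¹ ^ b, ?_, ?_⟩
  · simpa using (tendsto_pow_atTop_nhds_zero_of_lt_one (inv_nonneg.2 hlam0.le)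
      (inv_lt_one_of_one_lt₀ hlam1)).const_mul (∑ i, (H i 1 - H i 0))
  intro b
  induction b with
  | zero =>
    intro u x hx y hy
    have h1 : H (u 0) 1 - H (u 0) 0 ≤ ∑ i, (H i 1 - H i 0) :=
      Finset.single_le_sum (f := fun i => H i 1 - H i 0) (fun i _ => sub_nonneg.2 (h01 i))
        (Finset.mem_univ _)
    have hmem : ∀ z ∈ (R.rect (u 0)).inner,
        H (u 0) ((R.rect (u 0)).coord z).2 ∈ Icc (H (u 0) 0) (H (u 0) 1) := by
      intro z hz
      have hc := Ioo_subset_Icc_self ((R.rect (u 0)).coord_mem hz).2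
      exact ⟨(hH _).1.monotoneOn (left_mem_Icc.2 zero_le_one) hc hc.1,
        (hH _).1.monotoneOn hc (right_mem_Icc.2 zero_le_one) hc.2⟩
    obtain ⟨hx0, hx1⟩ := hmem x (R.cylinder_subset_inner 0 u hx)
    obtain ⟨hy0, hy1⟩ := hmem y (R.cylinder_subset_inner 0 u hy)
    simp only [pow_zero, mul_one]
    exact (abs_le.2 ⟨by linarith, by linarith⟩).trans h1
  | succ b ih =>
    intro u x hx y hy
    have h1 := Rectangle.abs_height_map hlam0 hlam hc' (hH (u 0)) (hH (u 1)) (hpre (u 0) (u 1))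
      (R.crossing_isHorizontallySaturated (u 0) (u 1)) (R.cylinder_succ_subset_crossing b u hx)
      (R.cylinder_succ_subset_crossing b u hy)
    have h2 := ih (fun z => u (z + 1)) (f x) hx.2 (f y) hy.2
    simp only [zero_add] at h2
    rw [h1] at h2
    simp only at h2 ⊢
    rw [pow_succ', mul_left_comm, ← div_eq_inv_mul, le_div_iff₀' hlam0]
    exact h2

/-! ### The projection of an admissible word -/

/-- The points whose iterates with times between `-m` and `m` visit the interiors of the rectangles
prescribed by `w`. -/
def biCylinder (w : ℤ → Fin n) (m : ℕ) : Set S :=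
  ⋂ z ∈ Icc (-(m : ℤ)) (m : ℤ), (f ^ z : S ≃ₜ S) ⁻¹' (R.rect (w z)).inner

lemma mem_biCylinder_iff {w : ℤ → Fin n} {m : ℕ} {x : S} :
    x ∈ R.biCylinder w m ↔
      ∀ z : ℤ, -(m : ℤ) ≤ z → z ≤ m → (f ^ z : S ≃ₜ S) x ∈ (R.rect (w z)).inner := by
  simp [biCylinder]

lemma isOpen_biCylinder (w : ℤ → Fin n) (m : ℕ) : IsOpen (R.biCylinder w m) :=
  (finite_Icc _ _).isOpen_biInter fun _ _ =>
    (R.rect _).isOpen_inner.preimage (Homeomorph.continuous _)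

lemma biCylinder_antitone (w : ℤ → Fin n) : Antitone (R.biCylinder w) := by
  intro m m' hm x hx
  rw [mem_biCylinder_iff] at hx ⊢
  exact fun z h1 h2 => hx z (by omega) (by omega)

/-- A two-sided cylinder is the intersection of a forward and a backward one. -/
lemma biCylinder_eq (w : ℤ → Fin n) (m : ℕ) :
    R.biCylinder w m = R.cylinder m (fun z => w z) ∩ R.dual.cylinder m (fun z => w (-z)) := by
  ext x
  rw [mem_biCylinder_iff, mem_inter_iff, mem_cylinder_iff, mem_cylinder_iff]
  have hinv : ∀ z : ℕ, (f ^ (-(z : ℤ)) : S ≃ₜ S) = f.symm ^ z := fun z => by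
    rw [zpow_neg, zpow_natCast, ← inv_pow]
    rfl
  have hin : ∀ i, (R.dual.rect i).inner = (R.rect i).inner := fun i => (R.rect i).inner_dual
  simp only [hin]
  constructor
  · intro h
    refine ⟨fun z hz => ?_, fun z hz => ?_⟩
    · have := h z (by omega) (by omega)
      rwa [zpow_natCast] at this
    · have := h (-z) (by omega) (by omega)
      rwa [hinv] at this
  · rintro ⟨h1, h2⟩ z hz hz'
    obtain ⟨k, rfl | rfl⟩ := z.eq_nat_or_neg
    · rw [zpow_natCast]
      exact h1 k (by omega)
    · rw [hinv]
      exact h2 k (by omega)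

lemma isPreconnected_crossing_dual (hpre : ∀ i j, IsPreconnected (R.crossing i j)) (i j : Fin n) :
    IsPreconnected (R.dual.crossing i j) := by
  rw [R.crossing_dual]
  exact (hpre j i).image f f.continuous.continuousOn

variable {R} in
lemma biCylinder_nonempty [T2Space S] (hf : IsPseudoAnosov M f) {w : ℤ → Fin n}
    (hw : ∀ z, (R.crossing (w z) (w (z + 1))).Nonempty) (m : ℕ) : (R.biCylinder w m).Nonempty := by
  obtain ⟨⟨x, hx⟩, hxs⟩ := R.cylinder_nonempty_and_saturated hf m (fun z => w z)
    fun z => by exact_mod_cast hw z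
  obtain ⟨⟨y, hy⟩, hys⟩ := R.dual.cylinder_nonempty_and_saturated hf.dual m (fun z => w (-z))
    fun z => by
      have h := (hw (-(z + 1))).image f
      rw [show (-(z + 1) : ℤ) + 1 = -z by ring] at h
      simpa only [R.crossing_dual, Nat.cast_add, Nat.cast_one] using h
  simp only [Nat.cast_zero, neg_zero] at hxs hys
  have hx' : x ∈ (R.rect (w 0)).inner := R.cylinder_subset_inner m _ hx
  have hy' : y ∈ (R.rect (w 0)).inner :=
    (R.rect (w 0)).inner_dual ▸ R.dual.cylinder_subset_inner m _ hy
  -- The horizontal leaf of `x` meets the vertical leaf of `y`.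
  rw [biCylinder_eq]
  refine ⟨_, hxs x hx _ ((R.rect (w 0)).coord_mem hy').1, ?_⟩
  have h := hys y hy _ ((R.rect (w 0)).coord_mem hx').2
  rw [show (R.dual.rect (w 0)).coord y = _ from (R.rect (w 0)).coord_dual hy'] at h
  exact h

lemma projectionSet_eq (w : ℤ → Fin n) : R.projectionSet w = ⋂ m, closure (R.biCylinder w m) := rfl

variable {R} in
/-- The closures of the two-sided cylinders of an admissible word shrink to a point. -/
theorem exists_projectionSet_eq_singleton [T2Space S] [CompactSpace S] (hf : IsPseudoAnosov M f)
    (hpre : ∀ i j, IsPreconnected (R.crossing i j)) {w : ℤ → Fin n}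
    (hw : ∀ z, (R.crossing (w z) (w (z + 1))).Nonempty) : ∃ x, R.projectionSet w = {x} := by
  have hne : (R.projectionSet w).Nonempty := by
    rw [projectionSet_eq]
    exact IsCompact.nonempty_iInter_of_sequence_nonempty_isCompact_isClosed _
      (fun m => closure_mono (R.biCylinder_antitone w m.le_succ))
      (fun m => (biCylinder_nonempty hf hw m).closure) isClosed_closure.isCompact
      fun m => isClosed_closure
  obtain ⟨H, hH, r, hr, hHr⟩ := R.exists_height_bound hf hpre
  obtain ⟨W, hW, r', hr', hWr⟩ := R.dual.exists_height_bound hf.dual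
    (R.isPreconnected_crossing_dual hpre)
  set P := R.rect (w 0) with hP
  let Q : ℕ → Set (ℝ × ℝ) := fun m => {a | a ∈ openSquare ∧ P.param a ∈ R.biCylinder w m}
  have hQsub : ∀ m, closure (Q m) ⊆ closedSquare := fun m => by
    rw [← closure_openSquare]
    exact closure_mono fun a ha => ha.1
  have hQc : ∀ m, IsCompact (closure (Q m)) := fun m =>
    (isCompact_Icc.prod isCompact_Icc).of_isClosed_subset isClosed_closure (hQsub m)
  have hQanti : ∀ m, closure (Q (m + 1)) ⊆ closure (Q m) := fun m =>
    closure_mono fun a ha => ⟨ha.1, R.biCylinder_antitone w m.le_succ ha.2⟩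
  have hQbound : ∀ m, ∀ a ∈ Q m, ∀ b ∈ Q m,
      |H (w 0) a.2 - H (w 0) b.2| ≤ r m ∧ |W (w 0) a.1 - W (w 0) b.1| ≤ r' m := by
    intro m a ha b hb
    have ha' := ha.2
    have hb' := hb.2
    rw [biCylinder_eq] at ha' hb'
    have h1 := hHr m _ _ ha'.1 _ hb'.1
    have h2 := hWr m _ _ ha'.2 _ hb'.2
    simp only [Nat.cast_zero, neg_zero] at h1 h2
    have e : ∀ c ∈ openSquare, (R.dual.rect (w 0)).coord (P.param c) = c.swap := fun c hc => by
      rw [show (R.dual.rect (w 0)).coord (P.param c) = _ from P.coord_dual ⟨c, hc, rfl⟩,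
        P.coord_param hc]
    rw [P.coord_param ha.1, P.coord_param hb.1] at h1
    rw [e a ha.1, e b hb.1] at h2
    exact ⟨h1, h2⟩
  -- The bounds pass to the closures.
  have hQbound' : ∀ m, ∀ p ∈ closure (Q m) ×ˢ closure (Q m),
      |H (w 0) p.1.2 - H (w 0) p.2.2| ≤ r m ∧ |W (w 0) p.1.1 - W (w 0) p.2.1| ≤ r' m := by
    intro m p hp
    have hp' := hp
    rw [← closure_prod_eq] at hp'
    have hH' : ContinuousOn (fun p : (ℝ × ℝ) × (ℝ × ℝ) => |H (w 0) p.1.2 - H (w 0) p.2.2|)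
        (closure (Q m ×ˢ Q m)) := by
      rw [closure_prod_eq]
      refine ContinuousOn.abs (ContinuousOn.sub ?_ ?_)
      · exact (hH (w 0)).2.1.comp (by fun_prop) fun p hp => (hQsub m hp.1).2
      · exact (hH (w 0)).2.1.comp (by fun_prop) fun p hp => (hQsub m hp.2).2
    have hW' : ContinuousOn (fun p : (ℝ × ℝ) × (ℝ × ℝ) => |W (w 0) p.1.1 - W (w 0) p.2.1|)
        (closure (Q m ×ˢ Q m)) := by
      rw [closure_prod_eq]
      refine ContinuousOn.abs (ContinuousOn.sub ?_ ?_)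
      · exact (hW (w 0)).2.1.comp (by fun_prop) fun p hp => (hQsub m hp.1).1
      · exact (hW (w 0)).2.1.comp (by fun_prop) fun p hp => (hQsub m hp.2).1
    constructor
    · refine closure_minimal (t := Iic (r m)) ?_ isClosed_Iic (hH'.image_closure ⟨p, hp', rfl⟩)
      rintro _ ⟨q, hq, rfl⟩
      exact (hQbound m q.1 hq.1 q.2 hq.2).1
    · refine closure_minimal (t := Iic (r' m)) ?_ isClosed_Iic (hW'.image_closure ⟨p, hp', rfl⟩)
      rintro _ ⟨q, hq, rfl⟩
      exact (hQbound m q.1 hq.1 q.2 hq.2).2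
  have hlift : ∀ x ∈ R.projectionSet w, ∃ a, (∀ m, a ∈ closure (Q m)) ∧ P.param a = x := by
    intro x hx
    have hcl : ∀ m, IsClosed (closure (Q m) ∩ P.param ⁻¹' {x}) := fun m =>
      (P.continuousOn.mono (hQsub m)).preimage_isClosed_of_isClosed isClosed_closure
        isClosed_singleton
    have hnon : ∀ m, (closure (Q m) ∩ P.param ⁻¹' {x}).Nonempty := by
      intro m
      have hsub : R.biCylinder w m ⊆ P.param '' closure (Q m) := by
        intro y hy
        have hy0 : y ∈ P.inner := by
          have := R.mem_biCylinder_iff.1 hy 0 (by omega) (by omega)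
          simpa using this
        refine ⟨P.coord y, subset_closure ⟨P.coord_mem hy0, ?_⟩, P.param_coord hy0⟩
        rwa [P.param_coord hy0]
      have hclosed : IsClosed (P.param '' closure (Q m)) :=
        ((hQc m).image_of_continuousOn (P.continuousOn.mono (hQsub m))).isClosed
      obtain ⟨a, ha, hax⟩ := closure_minimal hsub hclosed (mem_iInter.1 hx m)
      exact ⟨a, ha, hax⟩
    obtain ⟨a, ha⟩ := IsCompact.nonempty_iInter_of_sequence_nonempty_isCompact_isClosed _
      (fun m => inter_subset_inter_left (P.param ⁻¹' {x}) (hQanti m)) hnon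
      ((hQc 0).of_isClosed_subset (hcl 0) inter_subset_left) hcl
    rw [mem_iInter] at ha
    exact ⟨a, fun m => (ha m).1, (ha 0).2⟩
  obtain ⟨x, hx⟩ := hne
  refine ⟨x, (Set.eq_singleton_iff_unique_mem).2 ⟨hx, fun y hy => ?_⟩⟩
  obtain ⟨a, ha, rfl⟩ := hlift x hx
  obtain ⟨b, hb, rfl⟩ := hlift y hy
  have h1 : |H (w 0) b.2 - H (w 0) a.2| ≤ 0 :=
    ge_of_tendsto' hr fun m => (hQbound' m (b, a) ⟨hb m, ha m⟩).1
  have h2 : |W (w 0) b.1 - W (w 0) a.1| ≤ 0 :=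
    ge_of_tendsto' hr' fun m => (hQbound' m (b, a) ⟨hb m, ha m⟩).2
  have ha0 := hQsub 0 (ha 0)
  have hb0 := hQsub 0 (hb 0)
  rw [Prod.ext ((hW (w 0)).1.injOn hb0.1 ha0.1 (by linarith [abs_nonpos_iff.1 h2]))
    ((hH (w 0)).1.injOn hb0.2 ha0.2 (by linarith [abs_nonpos_iff.1 h1]))]

end MarkovPartition

/-! ### Sectors -/

namespace TransverseFoliations

variable (M : TransverseFoliations S)

lemma im_form_ne_zero_of_mem_sectorRegion {p x : S} {j : Fin (2 * M.prongs p)}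
    (hx : x ∈ M.sectorRegion p j) : (M.form p x).im ≠ 0 := by
  obtain ⟨-, r, θ, hr, h1, h2, h⟩ := hx
  have hk : (0 : ℝ) < M.prongs p := by exact_mod_cast M.prongs_pos p
  have hform : M.form p x = ((r ^ M.prongs p : ℝ) : ℂ)
      * Complex.exp (((M.prongs p * θ : ℝ) : ℂ) * Complex.I) := by
    rw [form, h, mul_pow, ← Complex.exp_nat_mul]
    push_cast
    congr 2
    ring
  rw [hform, Complex.im_ofReal_mul, Complex.exp_ofReal_mul_I_im]
  refine mul_ne_zero (by positivity) fun hs => ?_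
  obtain ⟨l, hl⟩ := Real.sin_eq_zero_iff.1 hs
  rw [div_lt_iff₀ hk] at h1
  rw [lt_div_iff₀ hk] at h2
  have h3 : (j : ℝ) < l := lt_of_mul_lt_mul_right (by linarith) Real.pi_pos.le
  have h4 : (l : ℝ) < (j : ℝ) + 1 := lt_of_mul_lt_mul_right (by linarith) Real.pi_pos.le
  have h5 : ((j : ℕ) : ℤ) < l := by exact_mod_cast h3
  have h6 : l < ((j : ℕ) : ℤ) + 1 := by exact_mod_cast h4
  omega

/-- The sectors fill the complement of the separatrices. -/
lemma exists_mem_sectorRegion {p x : S} (hx : x ∈ (M.chart p).source)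
    (h : (M.form p x).im ≠ 0) : ∃ j, x ∈ M.sectorRegion p j := by
  have hk : (0 : ℝ) < M.prongs p := by exact_mod_cast M.prongs_pos p
  have hπ := Real.pi_pos
  set z := M.chart p x with hz
  have hz0 : z ≠ 0 := by
    intro h0
    apply h
    rw [form, ← hz, h0, zero_pow (by have := M.prongs_pos p; omega), Complex.zero_im]
  obtain ⟨θ, hθ0, hθ1, hθ⟩ : ∃ θ : ℝ, 0 ≤ θ ∧ θ < 2 * Real.pi ∧
      z = (‖z‖ : ℂ) * Complex.exp (θ * Complex.I) := by
    rcases le_or_gt 0 z.arg with ha | ha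
    · exact ⟨z.arg, ha, by linarith [Complex.arg_le_pi z], (Complex.norm_mul_exp_arg_mul_I z).symm⟩
    · refine ⟨z.arg + 2 * Real.pi, by linarith [Complex.neg_pi_lt_arg z], by linarith, ?_⟩
      have h1 : ((z.arg + 2 * Real.pi : ℝ) : ℂ) * Complex.I
          = z.arg * Complex.I + 2 * Real.pi * Complex.I := by
        push_cast
        ring
      rw [h1, Complex.exp_add, Complex.exp_two_pi_mul_I, mul_one, Complex.norm_mul_exp_arg_mul_I]
  have hform : M.form p x = ((‖z‖ ^ M.prongs p : ℝ) : ℂ)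
      * Complex.exp (((M.prongs p * θ : ℝ) : ℂ) * Complex.I) := by
    rw [form, ← hz, hθ, mul_pow, ← Complex.exp_nat_mul]
    have : ‖(‖z‖ : ℂ) * Complex.exp (θ * Complex.I)‖ = ‖z‖ := by rw [← hθ]
    rw [this]
    push_cast
    congr 2
    ring
  have hnn : 0 ≤ M.prongs p * θ / Real.pi := by positivity
  have hlt : ⌊M.prongs p * θ / Real.pi⌋₊ < 2 * M.prongs p := by
    rw [Nat.floor_lt hnn, div_lt_iff₀ hπ]
    push_cast
    nlinarith
  have hfl := Nat.floor_le hnn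
  have hfl' := Nat.lt_floor_add_one (M.prongs p * θ / Real.pi)
  rw [le_div_iff₀ hπ] at hfl
  rw [div_lt_iff₀ hπ] at hfl'
  refine ⟨⟨_, hlt⟩, hx, ‖z‖, θ, norm_pos_iff.2 hz0, ?_, ?_, hθ⟩
  · rw [div_lt_iff₀ hk]
    refine lt_of_le_of_ne (by linarith) fun he => h ?_
    rw [hform, Complex.im_ofReal_mul, Complex.exp_ofReal_mul_I_im]
    have : Real.sin (M.prongs p * θ) = 0 := by
      rw [mul_comm _ θ, ← he]
      exact Real.sin_nat_mul_pi _
    rw [this, mul_zero]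
  · rw [lt_div_iff₀ hk]
    simp only
    linarith

/-- A point has arbitrarily small neighbourhoods that meet each sector in a nonempty connected
set. -/
lemma exists_nhds_inter_sectorRegion {p : S} (j : Fin (2 * M.prongs p)) {V : Set S}
    (hV : V ∈ 𝓝 p) : ∃ V' ∈ 𝓝 p, V' ⊆ V ∧ (V' ∩ M.sectorRegion p j).Nonempty ∧
      IsPreconnected (V' ∩ M.sectorRegion p j) := by
  have hk : (0 : ℝ) < M.prongs p := by exact_mod_cast M.prongs_pos p
  have hπ := Real.pi_pos
  set e := M.chart p with he
  have hp := M.mem_source p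
  have h0 : e p = 0 := M.chart_self p
  have h1 : e.target ∩ e.symm ⁻¹' V ∈ 𝓝 (0 : ℂ) := by
    have ht : e.target ∈ 𝓝 (0 : ℂ) := h0 ▸ e.open_target.mem_nhds (e.map_source hp)
    have hs : ContinuousAt e.symm 0 := e.symm.continuousAt (h0 ▸ e.map_source hp)
    refine inter_mem ht (hs ?_)
    rw [← h0, e.left_inv hp]
    exact hV
  obtain ⟨ε, hε, hball⟩ := Metric.mem_nhds_iff.1 h1
  set α := (j : ℝ) * Real.pi / M.prongs p with hα
  set β := ((j : ℝ) + 1) * Real.pi / M.prongs p with hβ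
  have hαβ : α < β := by
    rw [hα, hβ]
    gcongr
    linarith
  set polar : ℝ × ℝ → ℂ := fun a => (a.1 : ℂ) * Complex.exp (a.2 * Complex.I) with hpolar
  have hnorm : ∀ a : ℝ × ℝ, ‖polar a‖ = |a.1| := fun a => by
    rw [hpolar]
    simp only
    rw [norm_mul, Complex.norm_exp_ofReal_mul_I, mul_one, Complex.norm_real, Real.norm_eq_abs]
  have hpb : ∀ a ∈ Ioo 0 ε ×ˢ Ioo α β, polar a ∈ Metric.ball (0 : ℂ) ε := by
    intro a ha
    rw [mem_ball_zero_iff, hnorm, abs_of_pos ha.1.1]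
    exact ha.1.2
  have heq : (e.source ∩ e ⁻¹' Metric.ball 0 ε) ∩ M.sectorRegion p j
      = (fun a => e.symm (polar a)) '' (Ioo 0 ε ×ˢ Ioo α β) := by
    ext x
    constructor
    · rintro ⟨⟨hx, hb⟩, -, r, θ, hr, h1, h2, h⟩
      refine ⟨(r, θ), ⟨⟨hr, ?_⟩, h1, h2⟩, ?_⟩
      · have h3 := mem_ball_zero_iff.1 hb
        rw [he, h, show (r : ℂ) * Complex.exp (θ * Complex.I) = polar (r, θ) from rfl, hnorm,
          abs_of_pos hr] at h3
        exact h3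
      · change e.symm ((r : ℂ) * Complex.exp (θ * Complex.I)) = x
        rw [← h, ← he, e.left_inv hx]
    · rintro ⟨a, ha, rfl⟩
      have hat := (hball (hpb a ha)).1
      have hr : e (e.symm (polar a)) = polar a := e.right_inv hat
      refine ⟨⟨e.map_target hat, ?_⟩, e.map_target hat, a.1, a.2, ha.1.1, ha.2.1, ha.2.2, hr⟩
      rw [mem_preimage, hr]
      exact hpb a ha
  refine ⟨e.source ∩ e ⁻¹' Metric.ball 0 ε, ?_, ?_, ?_, ?_⟩
  · refine inter_mem (M.source_mem_nhds p) (e.continuousAt hp ?_)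
    rw [h0]
    exact Metric.ball_mem_nhds 0 hε
  · rintro x ⟨hx, hb⟩
    have := (hball hb).2
    rwa [mem_preimage, e.left_inv hx] at this
  · rw [heq]
    exact ((nonempty_Ioo.2 hε).prod (nonempty_Ioo.2 hαβ)).image _
  · rw [heq]
    refine (isPreconnected_Ioo.prod isPreconnected_Ioo).image _ ?_
    refine e.symm.continuousOn.comp ?_ fun a ha => (hball (hpb a ha)).1
    exact Continuous.continuousOn (by fun_prop)

lemma neBot_nhds_inf_sectorRegion {p : S} (j : Fin (2 * M.prongs p)) :
    (𝓝 p ⊓ 𝓟 (M.sectorRegion p j)).NeBot := by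
  rw [inf_principal_neBot_iff]
  intro V hV
  obtain ⟨V', -, hV'V, hne, -⟩ := M.exists_nhds_inter_sectorRegion j hV
  exact hne.mono (inter_subset_inter_left _ hV'V)

lemma sector_nonempty {p : S} (j : Fin (2 * M.prongs p)) : (M.sector p j).Nonempty := by
  have : (𝓝 p).IsCountablyGenerated := by
    rw [← (M.chart p).symm_map_nhds_eq (M.mem_source p)]
    infer_instance
  have := M.neBot_nhds_inf_sectorRegion j
  obtain ⟨y, hy⟩ := exists_seq_tendsto (𝓝 p ⊓ 𝓟 (M.sectorRegion p j))
  rw [tendsto_inf, tendsto_principal] at hy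
  exact ⟨y, hy⟩

/-- The separatrices of a point have empty interior: rotating a point of a separatrix slightly
about the centre of the chart moves it off the separatrices. -/
lemma exists_im_form_ne_zero {p : S} {U : Set S} (hU : IsOpen U) (hne : U.Nonempty)
    (hUp : U ⊆ (M.chart p).source) : ∃ x ∈ U, (M.form p x).im ≠ 0 := by
  have hk : (0 : ℝ) < M.prongs p := by exact_mod_cast M.prongs_pos p
  by_contra! hcon
  set e := M.chart p with he
  have hW : IsOpen (e '' U) := e.isOpen_image_of_subset_source hU hUp
  have him : ∀ z ∈ e '' U, (z ^ M.prongs p).im = 0 := by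
    rintro _ ⟨x, hx, rfl⟩
    exact hcon x hx
  obtain ⟨z, hz, hz0⟩ : ∃ z ∈ e '' U, z ≠ 0 := by
    obtain ⟨z, hz⟩ := hne.image e
    have h1 : ∀ᶠ w in 𝓝[≠] z, w ∈ e '' U := mem_nhdsWithin_of_mem_nhds (hW.mem_nhds hz)
    by_cases h0 : z = 0
    · obtain ⟨w, hw, hwz⟩ := (h1.and self_mem_nhdsWithin).exists
      exact ⟨w, hw, h0 ▸ hwz⟩
    · exact ⟨z, hz, h0⟩
  have hrot : Tendsto (fun θ : ℝ => z * Complex.exp (θ * Complex.I)) (𝓝[>] 0) (𝓝 z) := by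
    have hc : Continuous fun θ : ℝ => z * Complex.exp (θ * Complex.I) := by fun_prop
    have := hc.tendsto 0
    simp only [Complex.ofReal_zero, zero_mul, Complex.exp_zero, mul_one] at this
    exact this.mono_left nhdsWithin_le_nhds
  obtain ⟨θ, ⟨hθW, hθ1⟩, hθ0⟩ := (((hrot.eventually_mem (hW.mem_nhds hz)).and
    (mem_nhdsWithin_of_mem_nhds (Iio_mem_nhds (div_pos Real.pi_pos hk)))).and
      self_mem_nhdsWithin).exists
  have h1 := him _ hz
  have h2 := him _ hθW
  have h3 : (z ^ M.prongs p).re ≠ 0 := by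
    intro h
    exact pow_ne_zero (M.prongs p) hz0 (Complex.ext h h1)
  have h4 : Complex.exp (θ * Complex.I) ^ M.prongs p
      = Complex.exp (((M.prongs p * θ : ℝ) : ℂ) * Complex.I) := by
    rw [← Complex.exp_nat_mul]
    push_cast
    congr 1
    ring
  rw [mul_pow, h4, Complex.mul_im, h1, zero_mul, add_zero, Complex.exp_ofReal_mul_I_im] at h2
  have h5 : 0 < Real.sin (M.prongs p * θ) :=
    Real.sin_pos_of_pos_of_lt_pi (mul_pos hk hθ0) (by
      rw [lt_div_iff₀ hk] at hθ1
      linarith)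
  exact mul_ne_zero h3 h5.ne' h2

/-- Near any point, an injective path that runs inside a leaf stays on the separatrices of that
point. -/
lemma eventually_im_form_eq_zero_of_path [T2Space S] {γ : ℝ → S} (hc : ContinuousOn γ (Icc 0 1))
    (hi : InjOn γ (Icc 0 1))
    (h : ∀ t₀ ∈ Icc (0 : ℝ) 1, ∀ᶠ t in 𝓝[Icc 0 1] t₀, (M.form (γ t₀) (γ t)).im = 0) (p : S) :
    ∀ᶠ x in 𝓝 p, x ∈ γ '' Icc 0 1 → (M.form p x).im = 0 := by
  by_cases hp : p ∈ γ '' Icc 0 1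
  · obtain ⟨t₀, ht₀, rfl⟩ := hp
    obtain ⟨ε, hε, hball⟩ := Metric.mem_nhdsWithin_iff.1 (h t₀ ht₀)
    have hK : IsClosed (γ '' (Icc 0 1 \ Metric.ball t₀ ε)) :=
      ((isCompact_Icc.diff Metric.isOpen_ball).image_of_continuousOn
        (hc.mono sdiff_subset)).isClosed
    have hpK : γ t₀ ∉ γ '' (Icc 0 1 \ Metric.ball t₀ ε) := by
      rintro ⟨t, ht, he⟩
      exact ht.2 (hi ht.1 ht₀ he ▸ Metric.mem_ball_self hε)
    filter_upwards [hK.isOpen_compl.mem_nhds hpK] with x hx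
    rintro ⟨t, ht, rfl⟩
    by_contra hne
    exact hx ⟨t, ⟨ht, fun htb => hne (hball ⟨htb, ht⟩)⟩, rfl⟩
  · have hK : IsClosed (γ '' Icc 0 1) := (isCompact_Icc.image_of_continuousOn hc).isClosed
    filter_upwards [hK.isOpen_compl.mem_nhds hp] with x hx hx'
    exact absurd hx' hx

end TransverseFoliations

/-! ### Boundaries of rectangles near a point -/

/-- Near any point, the boundary of a rectangle is contained in the separatrices of that point. -/
lemma Rectangle.eventually_im_form_eq_zero [T2Space S] {M : TransverseFoliations S}
    (R : Rectangle M) (p : S) :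
    ∀ᶠ x in 𝓝 p, x ∈ R.carrier → x ∉ R.inner → (M.form p x).im = 0 := by
  have hh : ∀ t ∈ Icc (0 : ℝ) 1, ∀ᶠ x in 𝓝 p, x ∈ R.horizontalLeaf t → (M.form p x).im = 0 :=
    fun t ht => M.eventually_im_form_eq_zero_of_path (R.horizontal_stable t ht).1
      (R.horizontal_injOn t ht) (fun t₀ ht₀ => ((R.horizontal_stable t ht).2 t₀ ht₀).mono
        fun _ h => M.im_form_eq_zero_of_mem_stablePlaque h) p
  have hv : ∀ s ∈ Icc (0 : ℝ) 1, ∀ᶠ x in 𝓝 p, x ∈ R.verticalLeaf s → (M.form p x).im = 0 :=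
    fun s hs => M.eventually_im_form_eq_zero_of_path (R.vertical_unstable s hs).1
      (R.vertical_injOn s hs) (fun t₀ ht₀ => ((R.vertical_unstable s hs).2 t₀ ht₀).mono
        fun _ h => M.im_form_eq_zero_of_mem_unstablePlaque h) p
  have m0 : (0 : ℝ) ∈ Icc (0 : ℝ) 1 := left_mem_Icc.2 zero_le_one
  have m1 : (1 : ℝ) ∈ Icc (0 : ℝ) 1 := right_mem_Icc.2 zero_le_one
  filter_upwards [hh 0 m0, hh 1 m1, hv 0 m0, hv 1 m1] with x h0 h1 v0 v1
  rintro ⟨⟨s, t⟩, ⟨hs, ht⟩, rfl⟩ hx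
  rcases hs.1.eq_or_lt with rfl | hs0
  · exact v0 ⟨t, ht, rfl⟩
  rcases hs.2.eq_or_lt with rfl | hs1
  · exact v1 ⟨t, ht, rfl⟩
  rcases ht.1.eq_or_lt with rfl | ht0
  · exact h0 ⟨s, hs, rfl⟩
  rcases ht.2.eq_or_lt with rfl | ht1
  · exact h1 ⟨s, hs, rfl⟩
  exact absurd ⟨(s, t), ⟨⟨hs0, hs1⟩, ht0, ht1⟩, rfl⟩ hx

lemma zpow_add_one_apply (f : S ≃ₜ S) (z : ℤ) (x : S) :
    (f ^ (z + 1) : S ≃ₜ S) x = f ((f ^ z : S ≃ₜ S) x) := by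
  rw [add_comm, zpow_one_add]
  rfl

lemma IsPseudoAnosov.im_form_zpow {M : TransverseFoliations S} {f : S ≃ₜ S}
    (hf : IsPseudoAnosov M f) (z : ℤ) (p : S) :
    ∀ᶠ x in 𝓝 p, (M.form ((f ^ z : S ≃ₜ S) p) ((f ^ z : S ≃ₜ S) x)).im = (M.form p x).im := by
  induction z with
  | zero => exact Eventually.of_forall fun x => rfl
  | succ z ih =>
    filter_upwards [ih, (f ^ (z : ℤ) : S ≃ₜ S).continuous.continuousAt.eventually
      (hf.im_form_map ((f ^ (z : ℤ) : S ≃ₜ S) p))] with x h1 h2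
    rw [zpow_add_one_apply, zpow_add_one_apply, h2, h1]
  | pred z ih =>
    have h : ∀ x, f ((f ^ (-(z : ℤ) - 1) : S ≃ₜ S) x) = (f ^ (-(z : ℤ)) : S ≃ₜ S) x := fun x => by
      rw [← zpow_add_one_apply, sub_add_cancel]
    filter_upwards [ih, (f ^ (-(z : ℤ) - 1) : S ≃ₜ S).continuous.continuousAt.eventually
      (hf.im_form_map ((f ^ (-(z : ℤ) - 1) : S ≃ₜ S) p))] with x h1 h2
    rw [← h2, h, h, h1]

namespace MarkovPartition

variable {M : TransverseFoliations S} {f : S ≃ₜ S} {n : ℕ} (R : MarkovPartition M f n)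

/-! ### Itineraries of sectors -/

/-- The image of a small sector under an iterate of `f` lies in the interior of a rectangle, since
it is connected and avoids the boundaries of all rectangles. -/
theorem exists_eventually_mem_inner [T2Space S] (hf : IsPseudoAnosov M f) (x : S)
    (j : Fin (2 * M.prongs x)) (z : ℤ) :
    ∃ i, ∀ᶠ q in 𝓝 x, q ∈ M.sectorRegion x j → (f ^ z : S ≃ₜ S) q ∈ (R.rect i).inner := by
  set g : S ≃ₜ S := f ^ z with hg
  have h1 : ∀ᶠ q in 𝓝 x, ∀ i, g q ∈ (R.rect i).carrier → g q ∉ (R.rect i).inner →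
      (M.form (g x) (g q)).im = 0 :=
    eventually_all.2 fun i =>
      g.continuous.continuousAt.eventually ((R.rect i).eventually_im_form_eq_zero (g x))
  obtain ⟨V, hV, hVsub, ⟨q₀, hq₀⟩, hpre⟩ :=
    M.exists_nhds_inter_sectorRegion j (h1.and (hf.im_form_zpow z x))
  have hsub : ∀ i, g '' (V ∩ M.sectorRegion x j) ⊆ (R.rect i).inner ∪ (R.rect i).carrierᶜ := by
    rintro i _ ⟨q, hq, rfl⟩
    by_contra hcon
    rw [mem_union, not_or, mem_compl_iff, not_not] at hcon
    obtain ⟨h2, h3⟩ := hVsub hq.1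
    exact M.im_form_ne_zero_of_mem_sectorRegion hq.2 (h3 ▸ h2 i hcon.2 hcon.1)
  obtain ⟨i, hi⟩ := mem_iUnion.1 (R.cover ▸ mem_univ (g q₀))
  refine ⟨i, mem_of_superset hV fun q hq hq' => ?_⟩
  have hq₀i : g q₀ ∈ (R.rect i).inner :=
    (hsub i ⟨q₀, hq₀, rfl⟩).resolve_right fun h => h hi
  exact IsPreconnected.subset_left_of_subset_union (R.rect i).isOpen_inner
    (R.rect i).isCompact_carrier.isClosed.isOpen_compl
    (disjoint_compl_right.mono_left (R.rect i).inner_subset_carrier) (hsub i)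
    ⟨g q₀, ⟨q₀, hq₀, rfl⟩, hq₀i⟩ (hpre.image g g.continuous.continuousOn) ⟨q, ⟨hq, hq'⟩, rfl⟩

/-- `v` is the itinerary of the `j`-th sector of `x`: the interior of the rectangle with index `v z`
contains the image under `f ^ z` of a small sector. This differs from `IsSectorCode` in that it
refers to interiors, and to germs of sets instead of sequences. -/
def IsItinerary (x : S) (j : Fin (2 * M.prongs x)) (v : ℤ → Fin n) : Prop :=
  ∀ z, ∀ᶠ q in 𝓝 x, q ∈ M.sectorRegion x j → (f ^ z : S ≃ₜ S) q ∈ (R.rect (v z)).inner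

variable {R}

lemma IsItinerary.isSectorCode_iff {x : S} {j : Fin (2 * M.prongs x)} {v : ℤ → Fin n}
    (hv : R.IsItinerary x j v) (w : ℤ → Fin n) : R.IsSectorCode x j w ↔ w = v := by
  constructor
  · intro hw
    funext z
    obtain ⟨y, hy⟩ := M.sector_nonempty j
    obtain ⟨m, ⟨h1, h2⟩, h3⟩ := (((hw z _ ⟨y, hy, rfl⟩).and hy.2).and
      (hy.1.eventually (hv z))).exists
    exact (R.eq_of_mem_inner_of_mem_carrier (h3 h2) h1).symm
  · rintro rfl z _ ⟨y, hy, rfl⟩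
    filter_upwards [hy.2, hy.1.eventually (hv z)] with m h1 h2
    exact (R.rect _).inner_subset_carrier (h2 h1)

lemma IsItinerary.crossing_nonempty {x : S} {j : Fin (2 * M.prongs x)} {v : ℤ → Fin n}
    (hv : R.IsItinerary x j v) (z : ℤ) : (R.crossing (v z) (v (z + 1))).Nonempty := by
  have := M.neBot_nhds_inf_sectorRegion j
  obtain ⟨q, h1, h2⟩ := ((((hv z).and (hv (z + 1))).filter_mono inf_le_left).and
    (inf_le_right (a := 𝓝 x) (mem_principal_self (M.sectorRegion x j)))).exists
  refine ⟨(f ^ z : S ≃ₜ S) q, h1.1 h2, ?_⟩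
  rw [mem_preimage, ← zpow_add_one_apply]
  exact h1.2 h2

lemma IsItinerary.mem_projectionSet {x : S} {j : Fin (2 * M.prongs x)} {v : ℤ → Fin n}
    (hv : R.IsItinerary x j v) : x ∈ R.projectionSet v := by
  rw [projectionSet_eq, mem_iInter]
  intro m
  rw [mem_closure_iff_nhds]
  intro V hV
  have := M.neBot_nhds_inf_sectorRegion j
  have h1 : ∀ᶠ q in 𝓝 x, ∀ z ∈ Icc (-(m : ℤ)) m,
      q ∈ M.sectorRegion x j → (f ^ z : S ≃ₜ S) q ∈ (R.rect (v z)).inner :=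
    (eventually_all_finite (finite_Icc _ _)).2 fun z _ => hv z
  obtain ⟨q, ⟨h2, h3⟩, h4⟩ := (((h1.and hV).filter_mono inf_le_left).and
    (inf_le_right (a := 𝓝 x) (mem_principal_self (M.sectorRegion x j)))).exists
  exact ⟨q, h3, R.mem_biCylinder_iff.2 fun z hz hz' => h2 z ⟨hz, hz'⟩ h4⟩

/-- A word that projects to `x` is the itinerary of one of the sectors of `x`: its two-sided
cylinders are open and accumulate at `x`, so each of them meets a small sector. -/
lemma exists_eq_of_mem_projectionSet {x : S} {v : Fin (2 * M.prongs x) → ℤ → Fin n}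
    (hv : ∀ j, R.IsItinerary x j (v j)) {w : ℤ → Fin n} (hx : x ∈ R.projectionSet w) :
    ∃ j, w = v j := by
  by_contra! hcon
  choose z hz using fun j => Function.ne_iff.1 (hcon j)
  have h1 : ∀ᶠ q in 𝓝 x, (∀ j, q ∈ M.sectorRegion x j →
      (f ^ z j : S ≃ₜ S) q ∈ (R.rect (v j (z j))).inner) ∧ q ∈ (M.chart x).source :=
    (eventually_all.2 fun j => hv j (z j)).and (M.source_mem_nhds x)
  obtain ⟨U, hU, hUo, hxU⟩ := eventually_nhds_iff.1 h1
  -- A bound for all `|z j|`, so that the cylinder of order `m` involves each time `z j`.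
  set m : ℕ := ∑ j, (z j).natAbs with hm
  have hx' : x ∈ closure (R.biCylinder w m) := by
    rw [projectionSet_eq] at hx
    exact mem_iInter.1 hx m
  obtain ⟨q, hq, him⟩ := M.exists_im_form_ne_zero (p := x) (hUo.inter (R.isOpen_biCylinder w m))
    (mem_closure_iff.1 hx' U hUo hxU) fun q hq => (hU q hq.1).2
  obtain ⟨j, hj⟩ := M.exists_mem_sectorRegion (hU q hq.1).2 him
  have hle : (z j).natAbs ≤ m :=
    Finset.single_le_sum (f := fun j => (z j).natAbs) (fun _ _ => Nat.zero_le _)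
      (Finset.mem_univ j)
  exact hz j (R.eq_of_mem_inner (R.mem_biCylinder_iff.1 hq.2 (z j) (by omega) (by omega))
    ((hU q hq.1).1 j hj))

/-- The homeomorphism acts on projections as the shift acts on words. -/
lemma map_mem_projectionSet {x : S} {w : ℤ → Fin n} (hx : x ∈ R.projectionSet w) :
    f x ∈ R.projectionSet fun z => w (z + 1) := by
  rw [projectionSet_eq, mem_iInter] at hx ⊢
  intro m
  refine closure_mono ?_ (f.image_closure _ ▸ mem_image_of_mem f (hx (m + 1)))
  rintro _ ⟨q, hq, rfl⟩
  rw [mem_biCylinder_iff] at hq ⊢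
  intro z hz hz'
  have := hq (z + 1) (by push_cast; omega) (by push_cast; omega)
  rw [zpow_add_one] at this
  exact this

/-- Words that agree on a long central block have nearby projections. -/
lemma continuous_of_projectionSet_eq [T2Space S] [CompactSpace S]
    {A : Matrix (Fin n) (Fin n) ℕ∞} {π : Subshift A → S}
    (hπ : ∀ w, R.projectionSet w.1 = {π w}) : Continuous π := by
  rw [continuous_iff_continuousAt]
  intro w U hU
  have hdir : Directed (· ⊇ ·) fun m => closure (R.biCylinder w.1 m) :=
    directed_of_isDirected_le fun _ _ h => closure_mono (R.biCylinder_antitone w.1 h)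
  obtain ⟨m, hm⟩ := exists_subset_nhds_of_isCompact hdir (fun m => isClosed_closure.isCompact)
    (U := U) (fun y hy => by
      have hy' : y ∈ R.projectionSet w.1 := hy
      rw [hπ w, mem_singleton_iff] at hy'
      rwa [hy'])
  have hcont : ∀ z, Continuous fun w' : Subshift A => w'.1 z := fun z =>
    (continuous_apply z).comp (continuous_subtype_val (p := fun w : ℤ → Fin n =>
      ∀ z, A (w z) (w (z + 1)) = 1))
  have hev : ∀ᶠ w' in 𝓝 w, ∀ z ∈ Icc (-(m : ℤ)) m, w'.1 z = w.1 z :=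
    (eventually_all_finite (finite_Icc _ _)).2 fun z _ =>
      (hcont z).continuousAt.eventually_mem (mem_nhds_discrete.2 (mem_singleton _))
  refine mem_map.2 (mem_of_superset hev fun w' hw' => hm ?_)
  have h1 : π w' ∈ R.projectionSet w'.1 := by
    rw [hπ w']
    rfl
  have h2 : R.biCylinder w'.1 m = R.biCylinder w.1 m := by
    ext q
    rw [mem_biCylinder_iff, mem_biCylinder_iff]
    refine forall_congr' fun z => forall_congr' fun hz => forall_congr' fun hz' => ?_
    rw [hw' z ⟨hz, hz'⟩]
  rw [← h2]
  exact mem_iInter.1 h1 m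

end MarkovPartition

end PseudoAnosov

theorem mainTheorem3 {S : Type*} [TopologicalSpace S] [T2Space S] [CompactSpace S]
    [ConnectedSpace S] (M : PseudoAnosov.TransverseFoliations S) (f : S ≃ₜ S)
    (hf : PseudoAnosov.IsPseudoAnosov M f) (n : ℕ) (R : PseudoAnosov.MarkovPartition M f n)
    (hA : PseudoAnosov.IsBinary R.incidenceMatrix) :
    ∃ π : PseudoAnosov.Subshift R.incidenceMatrix → S,
      (∀ w, R.projectionSet w.1 = {π w}) ∧
      Continuous π ∧
      Function.Surjective π ∧
      (∀ x, (π ⁻¹' {x}).Finite) ∧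
      (∀ w, f (π w) = π w.shift) ∧
      ∀ x, ∃ e : Fin (2 * M.prongs x) → PseudoAnosov.Subshift R.incidenceMatrix,
        (∀ j, ∀ w : ℤ → Fin n, R.IsSectorCode x j w ↔ w = (e j).1) ∧
        π ⁻¹' {x} = Set.range e ∧
        (π ⁻¹' {x}).encard ≤ 2 * M.prongs x := by
  have hcross : ∀ i k, R.incidenceMatrix i k = 1 ↔ (R.crossing i k).Nonempty := by
    intro i k
    rw [← R.incidenceMatrix_ne_zero_iff]
    rcases hA i k with h | h <;> simp [h]
  choose π hπ using fun w : PseudoAnosov.Subshift R.incidenceMatrix =>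
    PseudoAnosov.MarkovPartition.exists_projectionSet_eq_singleton hf (R.isPreconnected_crossing hA)
      fun z => (hcross _ _).1 (w.2 z)
  choose v hv using fun (x : S) (j : Fin (2 * M.prongs x)) =>
    show ∃ v, R.IsItinerary x j v from
      ⟨_, fun z => (R.exists_eventually_mem_inner hf x j z).choose_spec⟩
  let e : ∀ x, Fin (2 * M.prongs x) → PseudoAnosov.Subshift R.incidenceMatrix := fun x j =>
    ⟨v x j, fun z => (hcross _ _).2 ((hv x j).crossing_nonempty z)⟩
  have hmem : ∀ w x, π w = x ↔ x ∈ R.projectionSet w.1 := fun w x => by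
    rw [hπ w, mem_singleton_iff, eq_comm]
  have hfib : ∀ x, π ⁻¹' {x} = Set.range (e x) := by
    intro x
    ext w
    rw [mem_preimage, mem_singleton_iff, hmem]
    constructor
    · intro h
      obtain ⟨j, hj⟩ := PseudoAnosov.MarkovPartition.exists_eq_of_mem_projectionSet (hv x) h
      exact ⟨j, Subtype.ext hj.symm⟩
    · rintro ⟨j, rfl⟩
      exact (hv x j).mem_projectionSet
  refine ⟨π, hπ, PseudoAnosov.MarkovPartition.continuous_of_projectionSet_eq hπ, ?_, ?_, ?_, ?_⟩
  · intro x
    have hpos := M.prongs_pos x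
    exact ⟨e x ⟨0, by omega⟩, (hmem _ _).2 (hv x _).mem_projectionSet⟩
  · intro x
    rw [hfib x]
    exact Set.finite_range _
  · intro w
    have h1 : π w ∈ R.projectionSet w.1 := (hmem w (π w)).1 rfl
    have h2 : f (π w) ∈ R.projectionSet w.shift.1 :=
      PseudoAnosov.MarkovPartition.map_mem_projectionSet h1
    exact ((hmem w.shift _).2 h2).symm
  · intro x
    refine ⟨e x, fun j w => (hv x j).isSectorCode_iff w, hfib x, ?_⟩
    rw [hfib x, ← Set.image_univ]
    refine (Set.encard_image_le _ _).trans ?_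
    rw [Set.encard_univ, ENat.card_eq_coe_fintype_card, Fintype.card_fin]
    rw [Nat.cast_mul]
    rfl
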